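/- **Theorem (Multiway Split Cost).** *B-trees.* Let $B\ge 2$. A B-tree over a linearly ordered set of keys is either an empty (external) node, or a search tree in which every internal node with $b$ keys has $b+1$ children, $\lfloor B/2\rfloor\le b\le B$ for every non-root internal node, $1\le b\le B$ for the root, and all external nodes have the same depth. A node is stored in one block; a pointer to a tree carries the tree's height. For a tree with root keys $r_1<\dots<r_b$ we write $C_0,\dots,C_b$ for its children. *Model.* In the fork-join I/O model, reading a block or writing a fresh block costs $1$, a thread may fork up to $B$ threads and wait for them (adding $1$ to the span, and to the work $1$ plus the number of forked threads), each forked thread returns $O(1)$ words, and computation on data held by a thread is free. I/O work is the total cost, I/O span is the largest cost along a chain of dependent steps. *Algorithms.* A *B-Way-Join* is a procedure that turns any $b+1$ B-trees $T_0,\dots,T_b$ and $b\le B$ separating keys into a B-tree with all these keys (it may be told of some of the trees that their root has at least $\lfloor B/2\rfloor$ keys). Given a B-Way-Join, *Thread-Split*$(T,k,k')$ with $k<k'$ returns a B-tree with exactly the keys of $T$ in $(k,k')$: it returns the empty tree if $T$ is empty and returns $T$ if $(k,k')=(-\infty,\infty)$; at a leaf it copies the keys in the range to a new leaf (the empty tree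 if there are none); at another node, let $i$ be the number of root keys $\le k$ and $j$ the number of root keys $<k'$; if $i=j$ it returns Thread-Split$(C_i,k,k')$, and otherwise it computes $C_i'=$ Thread-Split$(C_i,k,\infty)$, $C_j'=$ Thread-Split$(C_j,-\infty,k')$ and returns the B-Way-Join of $C_i',C_{i+1},\dots,C_{j-1},C_j'$ with the keys $r_{i+1},\dots,r_j$. *Multi-Split* starts $d+1$ parallel threads, by $\lceil\log_B(d+1)\rceil$ levels of forks; thread $i$ loads $k_{i-1}$ and $k_i$ and runs Thread-Split$(T,k_{i-1},k_i)$, where $k_0=-\infty$, $k_{d+1}=\infty$; the $d+1$ resulting pointers are gathered along the fork tree into blocks. *Claim.* There is an absolute constant $C$ such that for every $B\ge 2$ and every linearly ordered set of keys there is a B-Way-Join with which the following holds. For every stored B-tree $T$ with $n$ keys and every stored array of $d\ge 1$ keys $k_1<\dots<k_d$, Multi-Split returns B-trees $T_1,\dots,T_{d+1}$, where $T_i$ contains exactly the keys of $T$ in the open interval $(k_{i-1},k_i)$, with $$\text{I/O span}\le C(\log_B d+\log_B n+1),\qquad \text{I/O work}\le C\,d\,(\log_B n+1),$$ while every thread holds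 at most $C(\log_B n+1)$ blocks in its local memory. (For $n=0$ read $\log_B n$ as $0$.) -/

import Mathlib

/-! ## Blocks, references and memory -/

/-- A reference to a tree: the height of the tree and the address of its root block.
Height `0` denotes the empty tree (an external node); the address is then irrelevant. -/
structure Ref where
  height : ℕ
  root : ℕ

/-- The reference to the empty tree. -/
def Ref.empty : Ref := ⟨0, 0⟩

/-- A block, the unit of transfer. It has room for `B` keys and `B + 1` references, that is,
for one B-tree node. -/
structure Block (B : ℕ) (α : Type*) where
  keys : List α
  refs : List Ref
  keys_le : keys.length ≤ B
  refs_le : refs.length ≤ B + 1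

/-- The block with the given contents (anything beyond the capacity is cut off). -/
def Block.ofLists (B : ℕ) {α : Type*} (ks : List α) (rs : List Ref) : Block B α :=
  ⟨ks.take B, rs.take (B + 1), List.length_take_le _ _, List.length_take_le _ _⟩

/-- The shared memory: addresses are natural numbers, `none` means unallocated. -/
abbrev Heap (B : ℕ) (α : Type*) := ℕ → Option (Block B α)

/-! ## The fork-join model with block transfers -/

/-- Programs of the model. A thread may read a block, write a block (at a fresh address, which it
is told), or fork at most `B` threads and wait for all of them; each of them hands back a constant
number of words (one `Ref`). Computation on the data which a thread holds is free, hence the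
continuations are arbitrary functions of these data. -/
inductive Prog (B : ℕ) (α : Type*) where
  | ret (r : Ref)
  | read (a : ℕ) (k : Block B α → Prog B α)
  | write (b : Block B α) (k : ℕ → Prog B α)
  | fork (m : ℕ) (hm : m ≤ B) (child : Fin m → Prog B α) (k : (Fin m → Ref) → Prog B α)

/-- Sequential composition. -/
def Prog.bind {B : ℕ} {α : Type*} : Prog B α → (Ref → Prog B α) → Prog B α
  | .ret r, f => f r
  | .read a k, f => .read a fun b => (k b).bind f
  | .write b k, f => .write b fun a => (k a).bind f
  | .fork m hm child k, f => .fork m hm child fun rs => (k rs).bind f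

/-- The outcome of a run: returned reference, final memory, and costs.
* `work`: I/O work, the total number of block transfers, plus the cost of forking;
* `span`: I/O span, the cost of the longest chain of dependent steps;
* `space`: the largest number of blocks that a single thread has to hold in its local memory,
  counted as if no block were ever dropped and as if a forked thread inherited all blocks of
  its parent. -/
structure Outcome (B : ℕ) (α : Type*) where
  val : Ref
  heap : Heap B α
  work : ℕ
  span : ℕ
  space : ℕ

/-- The semantics. `s` is the supply of fresh addresses of the running thread. Forked threads get
disjoint parts of the supply, all of them start from the memory as it is at the fork (so no thread
sees what a parallel one writes), and at the join what they wrote is merged. Forking `m ≤ B`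
threads costs one step of span. -/
def Prog.run {B : ℕ} {α : Type*} : Prog B α → (s : ℕ → ℕ) → Heap B α → Outcome B α
  | .ret r, _, H => ⟨r, H, 0, 0, 0⟩
  | .read a k, s, H =>
      let o := (k ((H a).getD (Block.ofLists B [] []))).run s H
      ⟨o.val, o.heap, 1 + o.work, 1 + o.span, 1 + o.space⟩
  | .write b k, s, H =>
      let o := (k (s 0)).run (fun j => s (j + 1)) (Function.update H (s 0) (some b))
      ⟨o.val, o.heap, 1 + o.work, 1 + o.span, 1 + o.space⟩
  | .fork m _ child k, s, H =>
      let c := fun i : Fin m => (child i).run (fun j => s (Nat.pair (i + 1) j)) H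
      let o := (k fun i => (c i).val).run (fun j => s (Nat.pair 0 j))
        (fun a => (H a).or ((List.finRange m).findSome? fun i => (c i).heap a))
      ⟨o.val, o.heap,
        1 + m + (∑ i, (c i).work) + o.work,
        1 + (Finset.univ.sup fun i => (c i).span) + o.span,
        max (Finset.univ.sup fun i => (c i).space) (1 + o.space)⟩

/-- `s` enumerates, without repetition, unallocated addresses of the memory `H`. -/
def FreshSupply {B : ℕ} {α : Type*} (s : ℕ → ℕ) (H : Heap B α) : Prop :=
  Function.Injective s ∧ ∀ j, H (s j) = none

/-! ## B-trees in memory -/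

/-- `L₀ k₁ L₁ k₂ L₂ …`, the in-order sequence of a node with keys `k₁, k₂, …` whose subtrees have
the in-order sequences `L₀, L₁, …`. -/
def interleave {α : Type*} : List (List α) → List α → List α
  | L :: Ls, k :: ks => L ++ k :: interleave Ls ks
  | Ls, [] => Ls.flatten
  | [], ks => ks

/-- `r` refers to a tree of height `h` stored in `H`, with in-order key sequence `L`, in which
every node has one child more than it has keys, the root has at least `m` keys, every other node
has at least `⌊B/2⌋` keys, every node has at most `B` keys (the capacity of a block), and all
external nodes have the same depth. -/
def IsSubtree {B : ℕ} {α : Type*} (H : Heap B α) : (h m : ℕ) → Ref → List α → Prop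
  | 0, _, r, L => r.height = 0 ∧ L = []
  | h + 1, m, r, L =>
      r.height = h + 1 ∧ ∃ b, H r.root = some b ∧ m ≤ b.keys.length ∧
        b.refs.length = b.keys.length + 1 ∧
        ∃ Ls : List (List α), List.Forall₂ (fun c Lc => IsSubtree H h (B / 2) c Lc) b.refs Ls ∧
          L = interleave Ls b.keys

/-- `r` refers to a B-tree stored in `H` whose keys, in increasing order, are `L`. It is a search
tree: its in-order key sequence is strictly increasing. The root, if there is one, has at least
one key. -/
def IsBTree {B : ℕ} {α : Type*} [LinearOrder α] (H : Heap B α) (r : Ref) (L : List α) : Prop :=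
  IsSubtree H r.height 1 r L ∧ L.Pairwise (· < ·)

/-! ## Splitting -/

/-- The type of implementations of B-way join. The arguments are trees and the keys between
them. A tree is marked `true` if the caller knows that its root is dense enough for an inner node
(as is the case for an untouched child of a B-tree node). -/
abbrev JoinProg (B : ℕ) (α : Type*) := List (Ref × Bool) → List α → Prog B α

/-- `J` is a B-way join: from `b + 1` B-trees (of arbitrary heights) and `b ≤ B` separating keys
it produces a B-tree with all their keys. -/
def IsBWayJoin {B : ℕ} {α : Type*} [LinearOrder α] (J : JoinProg B α) : Prop :=
  ∀ (H : Heap B α) (s : ℕ → ℕ) (ts : List (Ref × Bool)) (Ls : List (List α)) (ks : List α),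
    FreshSupply s H → ks.length ≤ B → ts.length = ks.length + 1 →
    List.Forall₂ (fun t L => IsBTree H t.1 L ∧
      (t.2 = true → IsSubtree H t.1.height (B / 2) t.1 L)) ts Ls →
    (interleave Ls ks).Pairwise (· < ·) →
    IsBTree ((J ts ks).run s H).heap ((J ts ks).run s H).val (interleave Ls ks)

/-- Thread-Split: the part of the tree of height `h` with root at address `a` that lies strictly
between `k₁` and `k₂`. At an inner node, `i` and `j` are the indices (from `0`) of the children
into which `k₁` and `k₂` fall. As long as `i = j` the search just descends; otherwise the two
boundary children are split recursively, and joined with the children and (copies of the) keys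
between them by the B-way join `J`. -/
def threadSplit {B : ℕ} {α : Type*} [LinearOrder α] (J : JoinProg B α) :
    (h a : ℕ) → WithBot α → WithTop α → Prog B α
  | 0, _, _, _ => .ret Ref.empty
  | h + 1, a, k₁, k₂ =>
      if k₁ = ⊥ ∧ k₂ = ⊤ then .ret ⟨h + 1, a⟩
      else .read a fun b =>
        if h = 0 then
          let ks := b.keys.filter fun x : α => k₁ < (x : WithBot α) ∧ (x : WithTop α) < k₂
          if ks.length = 0 then .ret Ref.empty
          else .write (Block.ofLists B ks (List.replicate (ks.length + 1) Ref.empty)) fun a' =>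
            .ret ⟨1, a'⟩
        else
          let i := b.keys.countP fun x : α => (x : WithBot α) ≤ k₁
          let j := b.keys.countP fun x : α => (x : WithTop α) < k₂
          let ci := b.refs.getD i Ref.empty
          let cj := b.refs.getD j Ref.empty
          if i = j then threadSplit J h ci.root k₁ k₂
          else
            (threadSplit J h ci.root k₁ ⊤).bind fun ci' =>
            (threadSplit J h cj.root ⊥ k₂).bind fun cj' =>
              J ((ci', false) :: ((b.refs.drop (i + 1)).take (j - i - 1)).map (fun c => (c, true))
                  ++ [(cj', false)])
                ((b.keys.drop i).take (j - i))

/-- A parallel for loop over `m ≤ B ^ t` threads `lo, …, lo + m - 1`, by `t` levels of forks of at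
most `B` threads each. The results are gathered in blocks of up to `B` references: thread by thread
at the lowest level, and then block by block. -/
def parFor {B : ℕ} {α : Type*} (body : ℕ → Prog B α) : (t lo m : ℕ) → Prog B α
  | 0, lo, _ => body lo
  | t + 1, lo, m =>
      .fork (min B ((m + B ^ t - 1) / B ^ t)) (min_le_left _ _)
        (fun c => parFor body t (lo + c * B ^ t) (min (B ^ t) (m - c * B ^ t)))
        fun rs => .write (Block.ofLists B [] (List.ofFn rs)) fun a => .ret ⟨t + 1, a⟩

/-- `r` refers to the list `Ts` of references, stored by `t` levels of blocks. -/
def IsDirectory {B : ℕ} {α : Type*} (H : Heap B α) : (t : ℕ) → Ref → List Ref → Prop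
  | 0, r, Ts => Ts = [r]
  | t + 1, r, Ts => ∃ b, H r.root = some b ∧
      ∃ Tss : List (List Ref), List.Forall₂ (fun c Tc => IsDirectory H t c Tc) b.refs Tss ∧
        Ts = Tss.flatten

/-- The keys `ks` are stored in an array of consecutive blocks, `B` keys per block, which starts
at the address `base`. -/
def IsKeyArray {B : ℕ} {α : Type*} (H : Heap B α) (base : ℕ) (ks : List α) : Prop :=
  ∀ q, q * B < ks.length → ∃ b, H (base + q) = some b ∧ b.keys = (ks.drop (q * B)).take B

/-- The key before the `i`-th part (`i` counts from `0`), `-∞` for the first part. -/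
def lowerKey {α : Type*} (ks : List α) (i : ℕ) : WithBot α :=
  if i = 0 then ⊥ else (ks[i - 1]?).elim ⊥ WithBot.some

/-- The key after the `i`-th part (`i` counts from `0`), `+∞` for the last part. -/
def upperKey {α : Type*} (ks : List α) (i : ℕ) : WithTop α :=
  (ks[i]?).elim ⊤ WithTop.some

/-- Load the key with index `i` (from `0`) of the array at `base`, and continue. -/
def loadKey {B : ℕ} {α : Type*} (base i : ℕ) (k : Option α → Prog B α) : Prog B α :=
  .read (base + i / B) fun b => k (b.keys[i % B]?)

/-- The `i`-th thread (`i = 0, …, d`) of Multi-Split: it loads the two keys that bound its part,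
and runs Thread-Split. -/
def splitThread {B : ℕ} {α : Type*} [LinearOrder α] (J : JoinProg B α) (T : Ref) (base d i : ℕ) :
    Prog B α :=
  let withLower (k : WithBot α → Prog B α) : Prog B α :=
    if i = 0 then k ⊥ else loadKey base (i - 1) fun x => k (x.elim ⊥ WithBot.some)
  let withUpper (k : WithTop α → Prog B α) : Prog B α :=
    if i < d then loadKey base i fun x => k (x.elim ⊤ WithTop.some) else k ⊤
  withLower fun k₁ => withUpper fun k₂ => threadSplit J T.height T.root k₁ k₂

/-- Multi-Split: split the tree `T` by the `d` keys in the array at `base`, by `d + 1` parallel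
threads. -/
def multiSplit {B : ℕ} {α : Type*} [LinearOrder α] (J : JoinProg B α) (T : Ref) (base d : ℕ) :
    Prog B α :=
  parFor (splitThread J T base d) (Nat.clog B (d + 1)) 0 (d + 1)

/-! A single thread is sequential, so everything reduces to counting its transfers. Inserting a tree
of height `g` at a side of a tree of height `h ≥ g` means walking down the outer spine to height
`g`, fusing two roots there, and repairing overfull nodes on the way back: about `3 (h - g)`
transfers. In Thread-Split the trees strictly between the two boundary children are untouched, hence
dense and of equal height, and the boundary results are never higher. So the join consists of two
such insertions plus one new root, which fits into a block because each insertion produces at most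
one extra tree (`wp_bwayJoin_dense`).

Along one search path the join costs telescope. A split that is bounded on one side only satisfies
cost `≤ 18 h + 3 v`, where `v` is the height of the result. The term `3 v` pays for the insertion
one level up: that costs `3 (h - v) + O(1)`, and the new result has height at least `h`, since one
of the joined trees is a whole child. A two-sided split descends to the node where the two search
paths part and performs one one-sided split on each side, so it also costs `O(h)`
(`wp_threadSplit`). The height is `O(log_B n + 1)` because `B ≤ (⌊B/2⌋ + 1)²`
(`IsSubtree.height_le_logb`).

Finally, `run_parFor` adds the costs over the fork tree, where the fork and gather overhead is
linear in the number of threads plus the depth. Threads write to disjoint sets of fresh addresses,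
so their results survive the merging of the memories (`extends_merge`). -/

/-! ## Extension of memories -/

/-- Every block of `H` is still present in `H'`. -/
def Extends {B : ℕ} {α : Type*} (H H' : Heap B α) : Prop :=
  ∀ ⦃a b⦄, H a = some b → H' a = some b

theorem Extends.refl {B : ℕ} {α : Type*} (H : Heap B α) : Extends H H := fun _ _ h => h

theorem Extends.trans {B : ℕ} {α : Type*} {H H' H'' : Heap B α} (h : Extends H H')
    (h' : Extends H' H'') : Extends H H'' := fun _ _ e => h' (h e)

theorem extends_update {B : ℕ} {α : Type*} {H : Heap B α} {a : ℕ} (ha : H a = none)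
    (b : Block B α) : Extends H (Function.update H a (some b)) := by
  intro x y e
  rw [Function.update_of_ne]
  · exact e
  · rintro rfl
    simp [ha] at e

theorem IsSubtree.mono {B : ℕ} {α : Type*} {H H' : Heap B α} (hH : Extends H H') {h m m' : ℕ}
    (hm : m' ≤ m) {r : Ref} {L : List α} (ht : IsSubtree H h m r L) : IsSubtree H' h m' r L := by
  induction h generalizing m m' r L with
  | zero => exact ht
  | succ h ih =>
    obtain ⟨hr, b, hb, hmb, hl, Ls, hLs, rfl⟩ := ht
    exact ⟨hr, b, hH hb, hm.trans hmb, hl, Ls, hLs.imp fun _ _ h => ih le_rfl h, rfl⟩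

theorem IsSubtree.height_eq {B : ℕ} {α : Type*} {H : Heap B α} {h m : ℕ} {r : Ref} {L : List α}
    (ht : IsSubtree H h m r L) : r.height = h := by
  cases h with
  | zero => exact ht.1
  | succ h => exact ht.1

theorem Block.ofLists_keys {B : ℕ} {α : Type*} {ks : List α} (rs : List Ref)
    (h : ks.length ≤ B) : (Block.ofLists B ks rs).keys = ks := List.take_of_length_le h

theorem Block.ofLists_refs {B : ℕ} {α : Type*} (ks : List α) {rs : List Ref}
    (h : rs.length ≤ B + 1) : (Block.ofLists B ks rs).refs = rs := List.take_of_length_le h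

/-! ## Weakest preconditions of programs without forks -/

/-- The program `p` does not fork, and when it is started in the memory `H`, the returned
reference, the cost and the final memory satisfy `Q`, wherever new blocks are put. -/
def Prog.wp {B : ℕ} {α : Type*} :
    Prog B α → Heap B α → (Ref → ℕ → Heap B α → Prop) → Prop
  | .ret r, H, Q => Q r 0 H
  | .read a k, H, Q =>
      (k ((H a).getD (Block.ofLists B [] []))).wp H fun r c H' => Q r (c + 1) H'
  | .write b k, H, Q => ∀ a H', Extends H H' → H' a = some b →
      (k a).wp H' fun r c H'' => Q r (c + 1) H''
  | .fork .., _, _ => False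

theorem Prog.wp.mono {B : ℕ} {α : Type*} {p : Prog B α} {H : Heap B α}
    {Q Q' : Ref → ℕ → Heap B α → Prop} (h : p.wp H Q)
    (hQ : ∀ v c H', Extends H H' → Q v c H' → Q' v c H') : p.wp H Q' := by
  induction p generalizing H Q Q' with
  | ret r => exact hQ _ _ _ (Extends.refl H) h
  | read a k ih => exact ih _ h fun v c H' e => hQ v (c + 1) H' e
  | write b k ih =>
    exact fun a H' e ha => ih _ (h a H' e ha) fun v c H'' e' => hQ v (c + 1) H'' (e.trans e')
  | fork => exact h

theorem Prog.wp_bind {B : ℕ} {α : Type*} {p : Prog B α} {f : Ref → Prog B α} {H : Heap B α}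
    {Q : Ref → ℕ → Heap B α → Prop}
    (h : p.wp H fun r c H' => (f r).wp H' fun r' c' H'' => Q r' (c' + c) H'') :
    (p.bind f).wp H Q := by
  induction p generalizing H Q with
  | ret r => exact h
  | read a k ih => exact ih _ h
  | write b k ih => exact fun a H' e ha => ih _ (h a H' e ha)
  | fork => exact h.elim

theorem Prog.wp_read {B : ℕ} {α : Type*} {a : ℕ} {b : Block B α} {k : Block B α → Prog B α}
    {H : Heap B α} {Q : Ref → ℕ → Heap B α → Prop} (ha : H a = some b)
    (h : (k b).wp H fun r c H' => Q r (c + 1) H') : (Prog.read a k).wp H Q := by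
  simpa [Prog.wp, ha] using h

/-- A fork-free program changes the memory only at addresses of its supply, and its work, span and
space agree. -/
theorem Prog.wp.run {B : ℕ} {α : Type*} {p : Prog B α} {H : Heap B α} {s : ℕ → ℕ}
    {Q : Ref → ℕ → Heap B α → Prop} (h : p.wp H Q) (hs : FreshSupply s H) :
    Extends H (p.run s H).heap ∧ (∀ a, a ∉ Set.range s → (p.run s H).heap a = H a) ∧
      Q (p.run s H).val (p.run s H).work (p.run s H).heap ∧
      (p.run s H).span = (p.run s H).work ∧ (p.run s H).space = (p.run s H).work := by
  induction p generalizing H s Q with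
  | ret r => exact ⟨Extends.refl H, fun _ _ => rfl, h, rfl, rfl⟩
  | read a k ih =>
    obtain ⟨h1, h2, h3, h4, h5⟩ := ih _ h hs
    refine ⟨h1, h2, ?_, ?_, ?_⟩
    · simpa [Prog.run, add_comm] using h3
    · simpa [Prog.run] using h4
    · simpa [Prog.run] using h5
  | write b k ih =>
    have e := extends_update (hs.2 0) b
    have hs' : FreshSupply (fun j => s (j + 1)) (Function.update H (s 0) (some b)) := by
      refine ⟨fun x y hxy => by simpa using hs.1 hxy, fun j => ?_⟩
      rw [Function.update_of_ne]
      · exact hs.2 _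
      · intro hj
        simpa using hs.1 hj
    obtain ⟨h1, h2, h3, h4, h5⟩ :=
      ih _ (h (s 0) _ e (Function.update_self ..)) hs'
    refine ⟨e.trans h1, fun a ha => ?_, ?_, ?_, ?_⟩
    · refine (h2 a ?_).trans (Function.update_of_ne ?_ _ _)
      · rintro ⟨j, rfl⟩
        exact ha ⟨_, rfl⟩
      · rintro rfl
        exact ha ⟨_, rfl⟩
    · simpa [Prog.run, add_comm] using h3
    · simpa [Prog.run] using h4
    · simpa [Prog.run] using h5
  | fork => exact h.elim

/-! ## Contents of a node -/

/-- The length condition makes `k` the separator between the two groups of subtrees. All cutting and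
regrouping of nodes rests on this identity. -/
theorem interleave_append {α : Type*} {Ls₁ : List (List α)} {K₁ : List α}
    (h : Ls₁.length = K₁.length + 1) (Ls₂ : List (List α)) (k : α) (K₂ : List α) :
    interleave (Ls₁ ++ Ls₂) (K₁ ++ k :: K₂) =
      interleave Ls₁ K₁ ++ k :: interleave Ls₂ K₂ := by
  induction K₁ generalizing Ls₁ with
  | nil =>
    obtain ⟨L, rfl⟩ := List.length_eq_one_iff.1 h
    simp [interleave]
  | cons k' K₁ ih =>
    obtain _ | ⟨L, Ls₁⟩ := Ls₁
    · simp at h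
    · simp only [List.cons_append, interleave, List.append_assoc]
      rw [ih (by simpa using h)]

theorem interleave_singleton {α : Type*} (L : List α) : interleave [L] [] = L := by
  simp [interleave]

/-- `R` is a list of trees of height `h` whose roots have at least `m` keys, `K` are the keys between
them, and `L` is the sequence of all keys. -/
def IsForest {B : ℕ} {α : Type*} (H : Heap B α) (h m : ℕ) (R : List Ref) (K L : List α) : Prop :=
  R.length = K.length + 1 ∧
    ∃ Ls : List (List α), List.Forall₂ (fun c Lc => IsSubtree H h m c Lc) R Ls ∧
      L = interleave Ls K

theorem isSubtree_succ {B : ℕ} {α : Type*} {H : Heap B α} {h m : ℕ} {r : Ref} {L : List α} :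
    IsSubtree H (h + 1) m r L ↔ r.height = h + 1 ∧
      ∃ b, H r.root = some b ∧ m ≤ b.keys.length ∧ IsForest H h (B / 2) b.refs b.keys L :=
  Iff.rfl

/-! ### Cutting, concatenating and regrafting sequences of sibling trees. -/

namespace IsForest

variable {B : ℕ} {α : Type*} {H H' : Heap B α} {h m : ℕ} {R R₁ R₂ : List Ref}
  {K K₁ K₂ L L₁ L₂ : List α}

theorem mono (hH : Extends H H') {m' : ℕ} (hm : m' ≤ m) (hf : IsForest H h m R K L) :
    IsForest H' h m' R K L := by
  obtain ⟨hl, Ls, hLs, rfl⟩ := hf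
  exact ⟨hl, Ls, hLs.imp fun _ _ ht => ht.mono hH hm, rfl⟩

theorem singleton {c : Ref} (ht : IsSubtree H h m c L) : IsForest H h m [c] [] L :=
  ⟨rfl, [L], by simpa using ht, (interleave_singleton L).symm⟩

theorem exists_singleton (hf : IsForest H h m R [] L) : ∃ c, R = [c] ∧ IsSubtree H h m c L := by
  obtain ⟨hl, Ls, hLs, rfl⟩ := hf
  obtain ⟨c, rfl⟩ := List.length_eq_one_iff.1 hl
  obtain ⟨L, rfl⟩ := List.length_eq_one_iff.1 hLs.length_eq.symm
  exact ⟨c, rfl, by simpa [interleave] using hLs⟩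

theorem of_singleton {c : Ref} (hf : IsForest H h m [c] K L) : K = [] ∧ IsSubtree H h m c L := by
  have hK : K = [] := List.eq_nil_of_length_eq_zero (by simpa using hf.1.symm)
  subst hK
  obtain ⟨c', e, ht⟩ := hf.exists_singleton
  obtain rfl : c = c' := by simpa using e
  exact ⟨rfl, ht⟩

theorem append (h₁ : IsForest H h m R₁ K₁ L₁) (k : α) (h₂ : IsForest H h m R₂ K₂ L₂) :
    IsForest H h m (R₁ ++ R₂) (K₁ ++ k :: K₂) (L₁ ++ k :: L₂) := by
  obtain ⟨hl₁, Ls₁, hLs₁, rfl⟩ := h₁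
  obtain ⟨hl₂, Ls₂, hLs₂, rfl⟩ := h₂
  refine ⟨by simp [hl₁, hl₂]; omega, Ls₁ ++ Ls₂, List.rel_append hLs₁ hLs₂, ?_⟩
  rw [interleave_append (hLs₁.length_eq.symm.trans hl₁)]

theorem split {k : α} (hf : IsForest H h m R (K₁ ++ k :: K₂) L) :
    ∃ L₁ L₂, IsForest H h m (R.take (K₁.length + 1)) K₁ L₁ ∧
      IsForest H h m (R.drop (K₁.length + 1)) K₂ L₂ ∧ L = L₁ ++ k :: L₂ := by
  obtain ⟨hl, Ls, hLs, rfl⟩ := hf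
  have hl' := hLs.length_eq
  simp only [List.length_append, List.length_cons] at hl
  refine ⟨_, _, ⟨?_, Ls.take (K₁.length + 1), List.forall₂_take _ hLs, rfl⟩,
    ⟨?_, Ls.drop (K₁.length + 1), List.forall₂_drop _ hLs, rfl⟩, ?_⟩
  · simp; omega
  · simp; omega
  · conv_lhs => rw [← List.take_append_drop (K₁.length + 1) Ls]
    rw [interleave_append]
    simp; omega

/-- The replacement is an arbitrary forest, not one tree, because an insertion into the outer child
may split it in two. It may live in a later memory, where the siblings are still intact. -/
theorem subst_head {c : Ref} (hf : IsForest H h m (c :: R) K L) :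
    ∃ Lc X, L = Lc ++ X ∧ IsSubtree H h m c Lc ∧ ∀ H' m' R' K' L', Extends H H' → m' ≤ m →
      IsForest H' h m' R' K' L' → IsForest H' h m' (R' ++ R) (K' ++ K) (L' ++ X) := by
  obtain _ | ⟨k, K⟩ := K
  · obtain ⟨c', e, ht⟩ := hf.exists_singleton
    obtain ⟨rfl, rfl⟩ : c = c' ∧ R = [] := by simpa using e
    exact ⟨L, [], by simp, ht, fun H' m' R' K' L' _ _ hf' => by simpa using hf'⟩
  · obtain ⟨L₁, L₂, h₁, h₂, rfl⟩ := split (K₁ := []) hf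
    obtain ⟨-, ht⟩ := of_singleton (by simpa using h₁)
    refine ⟨L₁, k :: L₂, rfl, ht, fun H' m' R' K' L' e hm hf' => ?_⟩
    exact hf'.append k (by simpa using h₂.mono e hm)

theorem subst_last {c : Ref} (hf : IsForest H h m (R ++ [c]) K L) :
    ∃ Lc X, L = X ++ Lc ∧ IsSubtree H h m c Lc ∧ ∀ H' m' R' K' L', Extends H H' → m' ≤ m →
      IsForest H' h m' R' K' L' → IsForest H' h m' (R ++ R') (K ++ K') (X ++ L') := by
  obtain rfl | ⟨K, k, rfl⟩ := K.eq_nil_or_concat'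
  · obtain ⟨c', e, ht⟩ := hf.exists_singleton
    obtain ⟨rfl, rfl⟩ : R = [] ∧ c = c' := by
      obtain _ | ⟨x, R⟩ := R <;> simp_all
    exact ⟨L, [], by simp, ht, fun H' m' R' K' L' _ _ hf' => by simpa using hf'⟩
  · have hl : R.length = K.length + 1 := by simpa using hf.1
    obtain ⟨L₁, L₂, h₁, h₂, rfl⟩ := split (K₂ := []) hf
    rw [List.drop_left' hl] at h₂
    rw [List.take_left' hl] at h₁
    obtain ⟨-, ht⟩ := of_singleton h₂
    refine ⟨L₂, L₁ ++ [k], by simp, ht, fun H' m' R' K' L' e hm hf' => ?_⟩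
    simpa using (h₁.mono e hm).append k hf'

theorem ne_nil (hf : IsForest H h m R K L) : R ≠ [] := by
  rintro rfl
  simpa using hf.1

end IsForest

/-- A tree of height `h` with at least `m` keys in its root, or two dense trees and a key between
them. -/
def IsFragment {B : ℕ} {α : Type*} (H : Heap B α) (h m : ℕ) (R : List Ref) (K L : List α) : Prop :=
  K.length ≤ 1 ∧ IsForest H h (if K.length = 0 then m else B / 2) R K L

theorem IsFragment.forest {B : ℕ} {α : Type*} {H : Heap B α} {h : ℕ} {R : List Ref}
    {K L : List α} (hf : IsFragment H h (B / 2) R K L) : IsForest H h (B / 2) R K L := by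
  simpa using hf.2

/-! ## Inserting a tree at a side of another one -/

/-- Write the node of height `h + 1` with keys `K` and children `R`, as two nodes if it is too
large for a block; continue with the resulting keys and references. -/
def writeNode {B : ℕ} {α : Type*} (h : ℕ) (K : List α) (R : List Ref)
    (cont : List α → List Ref → Prog B α) : Prog B α :=
  if K.length ≤ B then
    .write (Block.ofLists B K R) fun a => cont [] [⟨h + 1, a⟩]
  else
    match K.drop (K.length / 2) with
    | [] => .ret Ref.empty
    | k :: K₂ =>
      .write (Block.ofLists B (K.take (K.length / 2)) (R.take (K.length / 2 + 1))) fun a =>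
        .write (Block.ofLists B K₂ (R.drop (K.length / 2 + 1))) fun a' =>
          cont [k] [⟨h + 1, a⟩, ⟨h + 1, a'⟩]

theorem isSubtree_of_ofLists {B : ℕ} {α : Type*} {H H' : Heap B α} {h m a : ℕ} {R : List Ref}
    {K L : List α} (hf : IsForest H h (B / 2) R K L) (hm : m ≤ K.length) (hK : K.length ≤ B)
    (e : Extends H H') (ha : H' a = some (Block.ofLists B K R)) :
    IsSubtree H' (h + 1) m ⟨h + 1, a⟩ L := by
  have hR : R.length ≤ B + 1 := by have := hf.1; omega
  refine ⟨rfl, _, ha, ?_⟩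
  rw [Block.ofLists_keys _ hK, Block.ofLists_refs _ hR]
  exact ⟨hm, hf.mono e le_rfl⟩

/-- Of `B + 1` to `2 * B + 1` keys the middle one moves up, and each half keeps between `B / 2` and
`B` keys; thus both new nodes are legal inner nodes. A continuation is used because a program
returns one reference, while here up to two trees and a key are passed on. -/
theorem wp_writeNode {B : ℕ} {α : Type*} {H : Heap B α} {h m : ℕ} {R : List Ref} {K L : List α}
    {cont : List α → List Ref → Prog B α} {Q : Ref → ℕ → Heap B α → Prop}
    (hf : IsForest H h (B / 2) R K L) (hm : m ≤ K.length) (hK : K.length ≤ 2 * B + 1)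
    (hcont : ∀ K' R' H' c₀, c₀ ≤ 2 → Extends H H' → IsFragment H' (h + 1) m R' K' L →
      (cont K' R').wp H' fun v c H'' => Q v (c + c₀) H'') :
    (writeNode h K R cont).wp H Q := by
  unfold writeNode
  split_ifs with hKB
  · intro a H' e ha
    refine hcont _ _ H' 1 (by norm_num) e ⟨by simp, .singleton ?_⟩
    simpa using isSubtree_of_ofLists hf hm hKB e ha
  · have hd : K.length / 2 < K.length := by omega
    rw [List.drop_eq_getElem_cons hd]
    have hlen : (K.take (K.length / 2)).length = K.length / 2 := by simp; omega
    obtain ⟨L₁, L₂, h₁, h₂, rfl⟩ := IsForest.split (K₁ := K.take (K.length / 2))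
      (k := K[K.length / 2]) (K₂ := K.drop (K.length / 2 + 1)) (R := R) (L := L) (H := H) (h := h)
      (m := B / 2) (by
        rw [← List.drop_eq_getElem_cons hd, List.take_append_drop]; exact hf)
    rw [hlen] at h₁ h₂
    intro a H' e ha a' H'' e' ha'
    refine hcont _ _ H'' 2 le_rfl (e.trans e') ⟨by simp, ?_⟩
    have t₁ := isSubtree_of_ofLists (m := B / 2) h₁ (by simp; omega) (by simp; omega) e ha
    have t₂ := isSubtree_of_ofLists (m := B / 2) h₂ (by simp; omega) (by simp; omega)
      (e.trans e') ha'
    exact (IsForest.singleton (t₁.mono e' le_rfl)).append _ (.singleton t₂)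

/-- Insert the tree `l` and the key `k` at the left end of the tree with height `h` and root
address `a`; the height of `l` should be at most `h`. -/
def insertLeft {B : ℕ} {α : Type*} (l : Ref) (k : α) :
    (h a : ℕ) → (List α → List Ref → Prog B α) → Prog B α
  | 0, _, cont => cont [k] [Ref.empty, Ref.empty]
  | h + 1, a, cont =>
    if l.height = h + 1 then
      .read l.root fun b => .read a fun b' =>
        writeNode h (b.keys ++ k :: b'.keys) (b.refs ++ b'.refs) cont
    else
      .read a fun b => insertLeft l k h (b.refs.headD Ref.empty).root fun K R =>
        writeNode h (K ++ b.keys) (R ++ b.refs.tail) cont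

/-- Insert the key `k` and the tree `r` at the right end of the tree with height `h` and root
address `a`; the height of `r` should be at most `h`. -/
def insertRight {B : ℕ} {α : Type*} (k : α) (r : Ref) :
    (h a : ℕ) → (List α → List Ref → Prog B α) → Prog B α
  | 0, _, cont => cont [k] [Ref.empty, Ref.empty]
  | h + 1, a, cont =>
    if r.height = h + 1 then
      .read a fun b => .read r.root fun b' =>
        writeNode h (b.keys ++ k :: b'.keys) (b.refs ++ b'.refs) cont
    else
      .read a fun b => insertRight k r h (b.refs.getLastD Ref.empty).root fun K R =>
        writeNode h (b.keys ++ K) (b.refs.dropLast ++ R) cont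

theorem isFragment_empties {B : ℕ} {α : Type*} (H : Heap B α) (m : ℕ) (k : α) :
    IsFragment H 0 m [Ref.empty, Ref.empty] [k] [k] :=
  have ht : IsSubtree H 0 (B / 2) Ref.empty [] := ⟨rfl, rfl⟩
  ⟨by simp, (IsForest.singleton ht).append k (.singleton ht)⟩

/-- Each level above the height of `l` costs one read and at most two writes, and the level of the
fusion two reads and two writes, whence the slope `3` and the constant `4`. The root of `l` may be
sparse, which is harmless: it is fused with a root of the same height, and the number of keys only
grows. -/
theorem wp_insertLeft {B : ℕ} {α : Type*} {H : Heap B α} {l : Ref} {k : α} {h m : ℕ} {r : Ref}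
    {Ll L : List α} {cont : List α → List Ref → Prog B α} {Q : Ref → ℕ → Heap B α → Prop}
    (hl : IsSubtree H l.height 1 l Ll) (hr : IsSubtree H h m r L) (hle : l.height ≤ h)
    (hcont : ∀ K R H' c₀, c₀ + 3 * l.height ≤ 3 * h + 4 → Extends H H' →
      IsFragment H' h m R K (Ll ++ k :: L) →
      (cont K R).wp H' fun v c H'' => Q v (c + c₀) H'') :
    (insertLeft l k h r.root cont).wp H Q := by
  induction h generalizing m r L cont Q with
  | zero =>
    obtain ⟨-, rfl⟩ := hr
    have h0 : l.height = 0 := by omega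
    rw [h0] at hl
    obtain ⟨-, rfl⟩ := hl
    exact hcont _ _ H 0 (by omega) (.refl H) (isFragment_empties H m k)
  | succ h ih =>
    obtain ⟨-, b, hb, hmb, hf⟩ := isSubtree_succ.1 hr
    unfold insertLeft
    split_ifs with hlh
    · rw [hlh] at hl
      obtain ⟨-, b', hb', -, hf'⟩ := isSubtree_succ.1 hl
      refine Prog.wp_read hb' (Prog.wp_read hb ?_)
      refine wp_writeNode (hf'.append k hf) (m := m) (by simp; omega) ?_
        fun K R H' c₀ hc₀ e hfr => ?_
      -- Two full nodes and the key between them give `2 * B + 1`, the most that two blocks and a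
      -- middle key can hold.
      · have := b.keys_le; have := b'.keys_le
        simp; omega
      · exact hcont K R H' (c₀ + 2) (by omega) e hfr
    · refine Prog.wp_read hb ?_
      obtain ⟨c, R, hR⟩ := List.exists_cons_of_ne_nil hf.ne_nil
      rw [hR] at hf ⊢
      obtain ⟨Lc, X, rfl, hc, hsub⟩ := hf.subst_head
      refine ih hc (by omega) fun K R' H' c₀ hc₀ e hfr => ?_
      refine wp_writeNode (m := m) (L := Ll ++ k :: (Lc ++ X)) ?_ (by simp; omega) ?_
        fun K' R'' H'' c₁ hc₁ e' hfr' => ?_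
      · simpa using hsub H' _ R' K _ e le_rfl hfr.forest
      · have := b.keys_le; have := hfr.1
        simp; omega
      · exact (hcont K' R'' H'' (c₁ + c₀ + 1) (by omega) (e.trans e') hfr').mono
          fun v c H' _ hq => by simpa [add_assoc] using hq

theorem wp_insertRight {B : ℕ} {α : Type*} {H : Heap B α} {l : Ref} {k : α} {h m : ℕ} {r : Ref}
    {L Lr : List α} {cont : List α → List Ref → Prog B α} {Q : Ref → ℕ → Heap B α → Prop}
    (hr : IsSubtree H r.height 1 r Lr) (hl : IsSubtree H h m l L) (hle : r.height ≤ h)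
    (hcont : ∀ K R H' c₀, c₀ + 3 * r.height ≤ 3 * h + 4 → Extends H H' →
      IsFragment H' h m R K (L ++ k :: Lr) →
      (cont K R).wp H' fun v c H'' => Q v (c + c₀) H'') :
    (insertRight k r h l.root cont).wp H Q := by
  induction h generalizing m l L cont Q with
  | zero =>
    obtain ⟨-, rfl⟩ := hl
    have h0 : r.height = 0 := by omega
    rw [h0] at hr
    obtain ⟨-, rfl⟩ := hr
    exact hcont _ _ H 0 (by omega) (.refl H) (isFragment_empties H m k)
  | succ h ih =>
    obtain ⟨-, b, hb, hmb, hf⟩ := isSubtree_succ.1 hl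
    unfold insertRight
    split_ifs with hrh
    · rw [hrh] at hr
      obtain ⟨-, b', hb', -, hf'⟩ := isSubtree_succ.1 hr
      refine Prog.wp_read hb (Prog.wp_read hb' ?_)
      refine wp_writeNode (hf.append k hf') (m := m) (by simp; omega) ?_
        fun K R H' c₀ hc₀ e hfr => ?_
      · have := b.keys_le; have := b'.keys_le
        simp; omega
      · exact hcont K R H' (c₀ + 2) (by omega) e hfr
    · refine Prog.wp_read hb ?_
      obtain ⟨R, c, hR⟩ := (List.eq_nil_or_concat' b.refs).resolve_left hf.ne_nil
      rw [hR] at hf ⊢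
      obtain ⟨Lc, X, rfl, hc, hsub⟩ := hf.subst_last
      rw [List.getLastD_concat, List.dropLast_concat]
      refine ih hc (by omega) fun K R' H' c₀ hc₀ e hfr => ?_
      refine wp_writeNode (m := m) (L := X ++ Lc ++ k :: Lr) ?_ (by simp; omega) ?_
        fun K' R'' H'' c₁ hc₁ e' hfr' => ?_
      · simpa using hsub H' _ R' K _ e le_rfl hfr.forest
      · have := b.keys_le; have := hfr.1
        simp; omega
      · exact (hcont K' R'' H'' (c₁ + c₀ + 1) (by omega) (e.trans e') hfr').mono
          fun v c H' _ hq => by simpa [add_assoc] using hq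

/-! ## Joins -/

/-- Turn a list of trees of height `h` and at most `B` keys between them into one tree. -/
def writeRoot {B : ℕ} {α : Type*} (h : ℕ) (K : List α) (R : List Ref) : Prog B α :=
  if K.length = 0 then .ret (R.headD Ref.empty)
  else .write (Block.ofLists B K R) fun a => .ret ⟨h + 1, a⟩

/-- Without keys the only tree stays a root, for which one key suffices; otherwise the trees become
inner nodes and must be dense. -/
theorem wp_writeRoot {B : ℕ} {α : Type*} {H : Heap B α} {h : ℕ} {R : List Ref} {K L : List α}
    (hf : IsForest H h (if K.length = 0 then 1 else B / 2) R K L) (hK : K.length ≤ B) :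
    (writeRoot h K R).wp H fun v c H' => IsSubtree H' v.height 1 v L ∧
      h ≤ v.height ∧ v.height ≤ h + 1 ∧ c ≤ 1 := by
  unfold writeRoot
  split_ifs at hf ⊢ with h0
  · rw [List.length_eq_zero_iff] at h0
    subst h0
    obtain ⟨c, rfl, ht⟩ := hf.exists_singleton
    have hc : c.height = h := ht.height_eq
    exact ⟨by simpa [hc] using ht, by simp [hc], by simp [hc], by simp⟩
  · intro a H' e ha
    exact ⟨isSubtree_of_ofLists hf (by omega) hK e ha, by simp, by simp, by simp⟩

/-- Join two trees with a key between them. -/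
def joinTwo {B : ℕ} {α : Type*} (l : Ref) (k : α) (r : Ref) : Prog B α :=
  if l.height ≤ r.height then insertLeft l k r.height r.root (writeRoot r.height)
  else insertRight k r l.height l.root (writeRoot l.height)

/-- The cost is `3` times the difference of the heights plus `5`. The symmetric form, with both
heights on the left, is the one that telescopes. -/
theorem wp_joinTwo {B : ℕ} (hB : 2 ≤ B) {α : Type*} {H : Heap B α} {l r : Ref} {k : α}
    {Ll Lr : List α} (hl : IsSubtree H l.height 1 l Ll) (hr : IsSubtree H r.height 1 r Lr) :
    (joinTwo l k r).wp H fun v c H' => IsSubtree H' v.height 1 v (Ll ++ k :: Lr) ∧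
      max l.height r.height ≤ v.height ∧ v.height ≤ max l.height r.height + 1 ∧
      c + 3 * l.height + 3 * r.height ≤ 6 * max l.height r.height + 5 := by
  unfold joinTwo
  split_ifs with h
  · refine wp_insertLeft hl hr h fun K R H' c₀ hc₀ e hf => ?_
    refine (wp_writeRoot hf.2 (by have := hf.1; omega)).mono fun v c H'' _ hq => ?_
    rw [max_eq_right h]
    exact ⟨hq.1, hq.2.1, hq.2.2.1, by omega⟩
  · have h' : r.height ≤ l.height := by omega
    refine wp_insertRight hr hl h' fun K R H' c₀ hc₀ e hf => ?_
    refine (wp_writeRoot hf.2 (by have := hf.1; omega)).mono fun v c H'' _ hq => ?_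
    rw [max_eq_left h']
    exact ⟨hq.1, hq.2.1, hq.2.2.1, by omega⟩

/-- Join the tree `l` with the trees of a list, one after the other. -/
def joinFold {B : ℕ} {α : Type*} (l : Ref) : List Ref → List α → Prog B α
  | r :: rs, k :: ks => (joinTwo l k r).bind fun l' => joinFold l' rs ks
  | _, _ => .ret l

/-- No cost is tracked: a split uses this fallback only for two trees, where it is a single
`joinTwo`. -/
theorem wp_joinFold {B : ℕ} (hB : 2 ≤ B) {α : Type*} {H : Heap B α} {l : Ref} {rs : List Ref}
    {L : List α} {Ls : List (List α)} {ks : List α} (hl : IsSubtree H l.height 1 l L)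
    (hlen : rs.length = ks.length)
    (hrs : List.Forall₂ (fun r Lr => IsSubtree H r.height 1 r Lr) rs Ls) :
    (joinFold l rs ks).wp H fun v _ H' => IsSubtree H' v.height 1 v (interleave (L :: Ls) ks) := by
  induction rs generalizing H l L Ls ks with
  | nil =>
    obtain rfl := List.eq_nil_of_length_eq_zero hlen.symm
    obtain rfl := List.forall₂_nil_left_iff.1 hrs
    simpa [joinFold, Prog.wp, interleave_singleton] using hl
  | cons r rs ih =>
    obtain ⟨k, ks, rfl⟩ := List.exists_cons_of_length_eq_add_one hlen.symm
    obtain ⟨Lr, Ls, hr, hrs', rfl⟩ := List.forall₂_cons_left_iff.1 hrs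
    refine Prog.wp_bind ?_
    have hw := wp_joinTwo hB (k := k) hl hr
    refine Prog.wp.mono (Q := fun v c H' => Extends H H' ∧
      IsSubtree H' v.height 1 v (L ++ k :: Lr)) (hw.mono fun v c H' e hq => ⟨e, hq.1⟩) ?_
    rintro v c H' - ⟨e, hv⟩
    refine (ih hv (by simpa using hlen)
      (hrs'.imp fun _ _ ht => ht.mono e le_rfl)).mono fun v' c' H'' _ hq => ?_
    cases ks with
    | nil => simpa [interleave] using hq
    | cons k' ks => simpa [interleave] using hq

/-- The B-way join. If the inner trees are dense and of the same height, and the outer ones are not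
higher, then the first and the last tree are inserted into their neighbours, and all get a common
root. Otherwise the trees are joined one after the other. -/
def bwayJoin {B : ℕ} {α : Type*} : JoinProg B α := fun ts ks =>
  let l := (ts.headD (Ref.empty, false)).1
  let r := (ts.getLastD (Ref.empty, false)).1
  let mid := ts.tail.dropLast
  let h := (mid.headD (Ref.empty, false)).1.height
  match ks, ks.getLast? with
  | k :: ks', some k' =>
    if mid ≠ [] ∧ (∀ t ∈ mid, t.2 = true ∧ t.1.height = h) ∧ l.height ≤ h ∧ r.height ≤ h then
      insertLeft l k h (mid.headD (Ref.empty, false)).1.root fun K R =>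
        insertRight k' r h ((R ++ mid.tail.map Prod.fst).getLastD Ref.empty).root fun K' R' =>
          writeRoot h (K ++ ks'.dropLast ++ K') ((R ++ mid.tail.map Prod.fst).dropLast ++ R')
    else joinFold l (ts.tail.map Prod.fst) ks
  | _, _ => .ret l

theorem bwayJoin_dense {B : ℕ} {α : Type*} {l r c : Ref} {f f' : Bool} {mid : List (Ref × Bool)}
    {k k' : α} {ks : List α} (hmid : ∀ t ∈ mid, t.2 = true ∧ t.1.height = c.height)
    (hl : l.height ≤ c.height) (hr : r.height ≤ c.height) :
    (bwayJoin ((l, f) :: (c, true) :: mid ++ [(r, f')]) (k :: ks ++ [k']) : Prog B α) =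
      insertLeft l k c.height c.root fun K R =>
        insertRight k' r c.height ((R ++ mid.map Prod.fst).getLastD Ref.empty).root fun K' R' =>
          writeRoot c.height (K ++ ks ++ K') ((R ++ mid.map Prod.fst).dropLast ++ R') := by
  have e : (((l, f) :: (c, true) :: mid) ++ [(r, f')]).tail.dropLast = (c, true) :: mid := by
    rw [List.cons_append, List.tail_cons, List.dropLast_concat]
  have e' : (((l, f) :: (c, true) :: mid) ++ [(r, f')]).getLastD (Ref.empty, false) = (r, f') :=
    List.getLastD_concat
  have e'' : (k :: ks ++ [k']).getLast? = some k' := List.getLast?_concat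
  unfold bwayJoin
  simp only [e, e', e'']
  simp only [List.cons_append, List.headD_cons, List.tail_cons, List.dropLast_concat]
  exact if_pos ⟨by simp, by simpa using hmid, hl, hr⟩

/-- Two insertions and one root: `4 + 4 + 1 = 9`. The keys `k` and `k'` disappear into the
neighbours, and each insertion returns at most one key, so the root receives at most `ks.length + 2`
keys. -/
theorem wp_bwayJoin_dense {B : ℕ} {α : Type*} {H : Heap B α} {l r : Ref} {f f' : Bool}
    {mid : List Ref} {k k' : α} {ks : List α} {h : ℕ} {Ll Lr L : List α}
    (hks : ks.length + 2 ≤ B)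
    (hlt : IsSubtree H l.height 1 l Ll) (hrt : IsSubtree H r.height 1 r Lr)
    (hf : IsForest H h (B / 2) mid ks L) (hl : l.height ≤ h) (hr : r.height ≤ h)
    (hmid : ∀ t ∈ mid, t.height = h) :
    (bwayJoin ((l, f) :: mid.map (fun c => (c, true)) ++ [(r, f')])
      (k :: ks ++ [k'])).wp H fun v c H' =>
        IsSubtree H' v.height 1 v (Ll ++ k :: L ++ k' :: Lr) ∧ h ≤ v.height ∧ v.height ≤ h + 1 ∧
        c + 3 * l.height + 3 * r.height ≤ 6 * h + 9 := by
  obtain ⟨c, mid, rfl⟩ := List.exists_cons_of_ne_nil hf.ne_nil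
  obtain rfl : c.height = h := hmid c (by simp)
  rw [List.map_cons, bwayJoin_dense (by simpa using fun t ht => hmid t (by simp [ht])) hl hr,
    List.map_map]
  have e : (mid.map (Prod.fst ∘ fun c : Ref => (c, true))) = mid := by
    simp [Function.comp_def]
  simp only [e]
  obtain ⟨Lc, X, rfl, hc, hsub⟩ := hf.subst_head
  refine wp_insertLeft hlt hc hl fun K R H' c₀ hc₀ e hfr => ?_
  have hf' := hsub H' _ R K _ e le_rfl hfr.forest
  -- With a single inner tree, `d` is that tree after the first insertion, or the right half of it.
  obtain ⟨R', d, hR'⟩ := (List.eq_nil_or_concat' (R ++ mid)).resolve_left hf'.ne_nil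
  rw [hR'] at hf' ⊢
  obtain ⟨Ld, Y, hY, hd, hsub'⟩ := hf'.subst_last
  rw [List.getLastD_concat, List.dropLast_concat]
  refine wp_insertRight (hrt.mono e le_rfl) hd hr fun K' R'' H'' c₁ hc₁ e' hfr' => ?_
  have hf'' := hsub' H'' _ R'' K' _ e' le_rfl hfr'.forest
  refine (wp_writeRoot (hf''.mono (.refl _) ?_) ?_).mono fun v c' H₃ _ hq => ⟨?_, hq.2.1,
    hq.2.2.1, ?_⟩
  -- Density gives `B / 2 ≥ 1` keys, since `hks` forces `B ≥ 2`.
  · split_ifs <;> omega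
  · have := hfr.1; have := hfr'.1
    simp; omega
  · have hL : Y ++ (Ld ++ k' :: Lr) = Ll ++ k :: (Lc ++ X) ++ k' :: Lr := by
      rw [← List.append_assoc, ← hY]
      simp
    exact hL ▸ hq.1
  · omega

theorem wp_bwayJoin {B : ℕ} (hB : 2 ≤ B) {α : Type*} {H : Heap B α} {ts : List (Ref × Bool)}
    {Ls : List (List α)} {ks : List α} (hks : ks.length ≤ B) (hlen : ts.length = ks.length + 1)
    (hts : List.Forall₂ (fun t L => IsSubtree H t.1.height 1 t.1 L ∧
      (t.2 = true → IsSubtree H t.1.height (B / 2) t.1 L)) ts Ls) :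
    (bwayJoin ts ks).wp H fun v _ H' => IsSubtree H' v.height 1 v (interleave Ls ks) := by
  obtain ⟨t, ts, rfl⟩ := List.exists_cons_of_length_eq_add_one hlen
  obtain ⟨L, Ls, ht, hts', rfl⟩ := List.forall₂_cons_left_iff.1 hts
  obtain _ | ⟨k, ks⟩ := ks
  · obtain rfl : ts = [] := by simpa using hlen
    obtain rfl := List.forall₂_nil_left_iff.1 hts'
    simpa [bwayJoin, Prog.wp, interleave_singleton] using ht.1
  obtain rfl | ⟨mid, u, rfl⟩ := ts.eq_nil_or_concat'
  · simp at hlen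
  have e : (t :: (mid ++ [u])).tail.dropLast = mid := by
    rw [List.tail_cons, List.dropLast_concat]
  have e' : (t :: (mid ++ [u])).getLastD (Ref.empty, false) = u := by
    rw [← List.cons_append, List.getLastD_concat]
  by_cases hc : mid ≠ [] ∧ (∀ x ∈ mid, x.2 = true ∧
      x.1.height = (mid.headD (Ref.empty, false)).1.height) ∧
      t.1.height ≤ (mid.headD (Ref.empty, false)).1.height ∧
      u.1.height ≤ (mid.headD (Ref.empty, false)).1.height
  · obtain ⟨hne, hd, hl, hr⟩ := hc
    generalize (mid.headD (Ref.empty, false)).1.height = h at hd hl hr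
    obtain ⟨ks, k', rfl⟩ := (ks.eq_nil_or_concat').resolve_left (by
      rintro rfl
      exact hne (by simpa using hlen))
    -- All flags are `true`, so the marked list can be recovered from its references.
    have hmap : mid = (mid.map Prod.fst).map fun c => (c, true) := by
      rw [List.map_map]
      conv_lhs => rw [← List.map_id mid]
      exact List.map_congr_left fun x hx => Prod.ext rfl (hd x hx).1
    have hm := List.forall₂_take mid.length hts'
    have hu₀ := List.forall₂_drop mid.length hts'
    rw [List.take_left] at hm
    rw [List.drop_left] at hu₀
    rw [← List.take_append_drop mid.length Ls]
    generalize List.take mid.length Ls = Lm at hm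
    generalize List.drop mid.length Ls = Lu at hu₀
    obtain ⟨Lu, Z, hu, hnil, rfl⟩ := List.forall₂_cons_left_iff.1 hu₀
    obtain rfl := List.forall₂_nil_left_iff.1 hnil
    have hml : mid.length = ks.length + 1 := by simpa using hlen
    have hf : IsForest H h (B / 2) (mid.map Prod.fst) ks (interleave Lm ks) := by
      refine ⟨by simpa using hml, Lm, List.forall₂_map_left_iff.2 ?_, rfl⟩
      rw [List.forall₂_iff_zip] at hm ⊢
      refine ⟨hm.1, fun {x Lx} hx => ?_⟩
      have := (hd x (List.of_mem_zip hx).1)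
      exact this.2 ▸ (hm.2 hx).2 this.1
    have hw := wp_bwayJoin_dense (f := t.2) (f' := u.2) (k := k) (k' := k')
      (by simpa [Nat.succ_le_iff] using hks) ht.1 hu.1 hf hl hr (by
        intro c hc
        obtain ⟨x, hx, rfl⟩ := List.mem_map.1 hc
        exact (hd x hx).2)
    rw [← hmap] at hw
    refine hw.mono fun v _ H' _ hq => ?_
    have h₁ := interleave_append (Ls₁ := [L]) (K₁ := []) rfl (Lm ++ [Lu]) k (ks ++ [k'])
    have h₂ := interleave_append (hm.length_eq.symm.trans hml) [Lu] k' []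
    simp only [List.singleton_append, List.nil_append, interleave_singleton] at h₁ h₂
    rw [h₁, h₂]
    simpa using hq.1
  · have hb : bwayJoin (B := B) (t :: (mid ++ [u])) (k :: ks) =
        joinFold t.1 ((mid ++ [u]).map Prod.fst) (k :: ks) := by
      have e'' : (k :: ks).getLast? = some ((k :: ks).getLast (by simp)) :=
        List.getLast?_eq_some_getLast _
      unfold bwayJoin
      simp only [e, e', e'']
      exact if_neg hc
    rw [hb]
    refine wp_joinFold hB ht.1 (by simpa using hlen) (List.forall₂_map_left_iff.2 ?_)
    exact hts'.imp fun _ _ h => h.1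

theorem isBWayJoin_bwayJoin {B : ℕ} (hB : 2 ≤ B) {α : Type*} [LinearOrder α] :
    IsBWayJoin (bwayJoin : JoinProg B α) := by
  intro H s ts Ls ks hs hks hlen hts hsort
  exact ⟨((wp_bwayJoin hB hks hlen (hts.imp fun _ _ h => ⟨h.1.1, h.2⟩)).run hs).2.2.1, hsort⟩

/-! ## Cutting a node -/

namespace IsForest

variable {B : ℕ} {α : Type*} {H : Heap B α} {h m : ℕ} {R : List Ref} {K L : List α}

theorem keys_sublist (hf : IsForest H h m R K L) : K.Sublist L := by
  induction K generalizing R L with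
  | nil => exact List.nil_sublist _
  | cons k K ih =>
    obtain ⟨L₁, L₂, -, h₂, rfl⟩ := split (K₁ := []) hf
    exact ((ih h₂).cons_cons k).trans (List.sublist_append_right _ _)

theorem eq_keys (hf : IsForest H 0 m R K L) : L = K := by
  induction K generalizing R L with
  | nil =>
    obtain ⟨c, -, -, rfl⟩ := hf.exists_singleton
    rfl
  | cons k K ih =>
    obtain ⟨L₁, L₂, h₁, h₂, rfl⟩ := split (K₁ := []) hf
    obtain ⟨c, -, -, rfl⟩ := h₁.exists_singleton
    rw [ih h₂, List.nil_append]

theorem replicate_empty (H : Heap B α) (m : ℕ) (K : List α) :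
    IsForest H 0 m (List.replicate (K.length + 1) Ref.empty) K K := by
  have ht : IsSubtree H 0 m Ref.empty [] := ⟨rfl, rfl⟩
  induction K with
  | nil => exact .singleton ht
  | cons k K ih => exact (singleton ht).append k ih

/-- In a search tree everything to the left of child `i` is bounded by the last key before it. Hence
a bound on the removed node keys controls all removed keys. -/
theorem cut_left [LinearOrder α] (hf : IsForest H h m R K L) (hL : L.Pairwise (· < ·)) {i : ℕ}
    (hi : i ≤ K.length) : ∃ X L', L = X ++ L' ∧ (∀ x ∈ X, ∃ y ∈ K.take i, x ≤ y) ∧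
      IsForest H h m (R.drop i) (K.drop i) L' := by
  obtain _ | i := i
  · exact ⟨[], L, rfl, by simp, hf⟩
  · have hlen : (K.take i).length = i := by simp; omega
    obtain ⟨L₁, L₂, h₁, h₂, rfl⟩ := split (K₁ := K.take i) (k := K[i]) (K₂ := K.drop (i + 1))
      (by rw [← List.drop_eq_getElem_cons, List.take_append_drop]; exact hf)
    rw [hlen] at h₂
    refine ⟨L₁ ++ [K[i]], L₂, by simp, fun x hx => ⟨K[i], ?_, ?_⟩, h₂⟩
    · exact List.mem_take_iff_getElem.2 ⟨i, by omega, rfl⟩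
    · rw [List.mem_append, List.mem_singleton] at hx
      obtain hx | rfl := hx
      · exact ((List.pairwise_append.1 hL).2.2 x hx _ (by simp)).le
      · exact le_rfl

theorem cut_right [LinearOrder α] (hf : IsForest H h m R K L) (hL : L.Pairwise (· < ·)) {j : ℕ}
    (hj : j ≤ K.length) : ∃ L' Y, L = L' ++ Y ∧ (∀ y ∈ Y, ∃ z ∈ K.drop j, z ≤ y) ∧
      IsForest H h m (R.take (j + 1)) (K.take j) L' := by
  obtain rfl | hj := hj.eq_or_lt
  · refine ⟨L, [], by simp, by simp, ?_⟩
    rw [← hf.1]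
    simpa using hf
  · have hlen : (K.take j).length = j := by simp; omega
    obtain ⟨L₁, L₂, h₁, h₂, rfl⟩ := split (K₁ := K.take j) (k := K[j]) (K₂ := K.drop (j + 1))
      (by rw [← List.drop_eq_getElem_cons, List.take_append_drop]; exact hf)
    rw [hlen] at h₁
    refine ⟨L₁, K[j] :: L₂, rfl, fun y hy => ⟨K[j], ?_, ?_⟩, h₁⟩
    · rw [List.drop_eq_getElem_cons hj]
      exact List.mem_cons_self
    · obtain rfl | hy := List.mem_cons.1 hy
      · exact le_rfl
      · exact ((List.pairwise_cons.1 (List.pairwise_append.1 hL).2.1).1 y hy).le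

end IsForest

theorem countP_split {α : Type*} [LinearOrder α] {p : α → Bool}
    (hp : ∀ x y, x ≤ y → p y = true → p x = true) {K : List α} (hK : K.Pairwise (· < ·)) :
    (∀ x ∈ K.take (K.countP p), p x = true) ∧ ∀ x ∈ K.drop (K.countP p), ¬ p x = true := by
  induction K with
  | nil => simp
  | cons k K ih =>
    obtain ⟨hk, hK⟩ := List.pairwise_cons.1 hK
    by_cases hpk : p k = true
    · rw [List.countP_cons_of_pos hpk]
      obtain ⟨h₁, h₂⟩ := ih hK
      exact ⟨by simpa [hpk] using h₁, by simpa using h₂⟩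
    · have h0 : (k :: K).countP p = 0 := by
        rw [List.countP_eq_zero]
        intro x hx
        obtain rfl | hx := List.mem_cons.1 hx
        · exact hpk
        · exact fun h => hpk (hp _ _ (hk x hx).le h)
      rw [h0]
      refine ⟨by simp, List.countP_eq_zero.1 h0⟩

theorem take_drop_eq_cons_append {α : Type*} (R : List α) (d : α) {i j : ℕ} (hij : i < j)
    (hj : j < R.length) : (R.take (j + 1)).drop i =
      R.getD i d :: (R.drop (i + 1)).take (j - i - 1) ++ [R.getD j d] := by
  rw [List.drop_take, List.drop_eq_getElem_cons (hij.trans hj),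
    show j + 1 - i = j - i - 1 + 1 + 1 by omega, List.take_succ_cons,
    List.take_succ_eq_append_getElem (by simp; omega)]
  have : i + 1 + (j - i - 1) = j := by omega
  simp [List.getElem_drop, this, hj, hij.trans hj]

/-! ## Keys in an interval -/

/-- The elements of `L` strictly between `k₁` and `k₂`. -/
def keysBetween {α : Type*} [LinearOrder α] (k₁ : WithBot α) (k₂ : WithTop α) (L : List α) :
    List α :=
  L.filter fun x : α => k₁ < (x : WithBot α) ∧ (x : WithTop α) < k₂

theorem keysBetween_append {α : Type*} [LinearOrder α] (k₁ : WithBot α) (k₂ : WithTop α)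
    (L L' : List α) :
    keysBetween k₁ k₂ (L ++ L') = keysBetween k₁ k₂ L ++ keysBetween k₁ k₂ L' :=
  List.filter_append ..

theorem keysBetween_bot_top {α : Type*} [LinearOrder α] (L : List α) :
    keysBetween ⊥ ⊤ L = L := by
  simp [keysBetween, WithBot.bot_lt_coe, WithTop.coe_lt_top]

theorem keysBetween_eq_nil {α : Type*} [LinearOrder α] {k₁ : WithBot α} {k₂ : WithTop α}
    {L : List α} (h : ∀ x ∈ L, (x : WithBot α) ≤ k₁ ∨ k₂ ≤ (x : WithTop α)) :
    keysBetween k₁ k₂ L = [] := by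
  refine List.filter_eq_nil_iff.2 fun x hx => ?_
  rw [decide_eq_true_eq]
  rintro ⟨h₁, h₂⟩
  exact (h x hx).elim (fun h => absurd h₁ h.not_gt) fun h => absurd h₂ h.not_gt

/-- The ends of `W` lie inside the interval, hence so does all of `W`; what precedes `W` needs no
upper test and what follows it no lower one. This turns one two-sided split into two one-sided ones.
-/
theorem keysBetween_middle {α : Type*} [LinearOrder α] {k₁ : WithBot α} {k₂ : WithTop α}
    {L₀ W L₁ W₁ W₂ : List α} {k k' : α} (hs : (L₀ ++ W ++ L₁).Pairwise (· < ·))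
    (hk : W = k :: W₁) (hk' : W = W₂ ++ [k'])
    (h₁ : k₁ < (k : WithBot α)) (h₂ : (k' : WithTop α) < k₂) :
    keysBetween k₁ k₂ (L₀ ++ W ++ L₁) = keysBetween k₁ ⊤ L₀ ++ W ++ keysBetween ⊥ k₂ L₁ := by
  obtain ⟨hs₁, -, hs₃⟩ := List.pairwise_append.1 hs
  obtain ⟨-, hs₂, hs₁'⟩ := List.pairwise_append.1 hs₁
  have hkW : k ∈ W := by simp [hk]
  have hkW' : k' ∈ W := by simp [hk']
  have hlow : ∀ x ∈ W, k ≤ x := by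
    rw [hk] at hs₂ ⊢
    rintro x (_ | ⟨_, hx⟩)
    exacts [le_rfl, ((List.pairwise_cons.1 hs₂).1 x hx).le]
  have hhigh : ∀ x ∈ W, x ≤ k' := by
    intro x hx
    rw [hk'] at hs₂ hx
    rw [List.mem_append, List.mem_singleton] at hx
    obtain hx | rfl := hx
    exacts [((List.pairwise_append.1 hs₂).2.2 x hx k' (by simp)).le, le_rfl]
  have hbot : ∀ x, k ≤ x → k₁ < (x : WithBot α) := fun x hx =>
    h₁.trans_le (WithBot.coe_le_coe.2 hx)
  have htop : ∀ x, x ≤ k' → (x : WithTop α) < k₂ := fun x hx =>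
    (WithTop.coe_le_coe.2 hx).trans_lt h₂
  rw [keysBetween_append, keysBetween_append]
  congr 1
  · congr 1
    · refine List.filter_congr fun x hx => ?_
      have := htop x (hs₁' x hx k' hkW').le
      simp [this, WithTop.coe_lt_top]
    · refine List.filter_eq_self.2 fun x hx => ?_
      simp [htop x (hhigh x hx), hbot x (hlow x hx)]
  · refine List.filter_congr fun x hx => ?_
    have := hbot x (hs₃ k (by simp [hkW]) x hx).le
    simp [this, WithBot.bot_lt_coe]

/-! ## The cost of splitting by a single thread -/

/-- The join step of a split: the boundary children of a run of children are replaced by other trees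
that are not higher. -/
theorem wp_bwayJoin_boundary {B : ℕ} (hB : 2 ≤ B) {α : Type*} {H : Heap B α} {h : ℕ} {c c' : Ref}
    {mid : List Ref} {K M : List α} (hf : IsForest H h (B / 2) (c :: mid ++ [c']) K M)
    (hK : K.length ≤ B) :
    ∃ L₀ W L₁, M = L₀ ++ W ++ L₁ ∧ IsSubtree H h (B / 2) c L₀ ∧ IsSubtree H h (B / 2) c' L₁ ∧
      (∃ k ∈ K, ∃ W', W = k :: W') ∧ (∃ k ∈ K, ∃ W', W = W' ++ [k]) ∧
      ∀ H' l r Ll Lr, Extends H H' → IsSubtree H' l.height 1 l Ll → IsSubtree H' r.height 1 r Lr →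
        l.height ≤ h → r.height ≤ h →
        (bwayJoin ((l, false) :: mid.map (fun c => (c, true)) ++ [(r, false)]) K).wp H'
          fun v cost H'' => IsSubtree H'' v.height 1 v (Ll ++ W ++ Lr) ∧
            max l.height r.height ≤ v.height ∧ v.height ≤ h + 1 ∧
            cost + 3 * l.height + 3 * r.height ≤ 6 * h + 9 := by
  have hlen := hf.1
  obtain _ | ⟨k, K⟩ := K
  · simp at hlen
  obtain ⟨L₀, M', h₀, hM, rfl⟩ := IsForest.split (K₁ := []) hf
  obtain ⟨-, ht₀⟩ := IsForest.of_singleton (c := c) (by simpa using h₀)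
  obtain rfl | ⟨K, k', rfl⟩ := K.eq_nil_or_concat'
  · obtain rfl : mid = [] := by simpa using hlen
    obtain ⟨-, h₁⟩ := IsForest.of_singleton (by simpa using hM)
    refine ⟨L₀, [k], M', by simp, ht₀, h₁, ⟨k, by simp, [], rfl⟩, ⟨k, by simp, [], rfl⟩, ?_⟩
    intro H' l r Ll Lr e hl hr hlh hrh
    -- Without inner trees the dense case does not apply, and the fold consists of one step.
    have hb : bwayJoin (B := B) ((l, false) :: [].map (fun c => (c, true)) ++ [(r, false)]) [k] =
        (joinTwo l k r).bind .ret := rfl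
    rw [hb]
    refine Prog.wp_bind ((wp_joinTwo hB hl hr).mono fun v cost H'' _ hq => ?_)
    refine ⟨by simpa using hq.1, hq.2.1, ?_, ?_⟩
    · have := hq.2.2.1; omega
    · have := hq.2.2.2; omega
  · have hml : mid.length = K.length + 1 := by simpa using hlen
    obtain ⟨L, L₁, hm, h₁, rfl⟩ := IsForest.split (K₂ := []) hM
    have hd : ((c :: mid ++ [c']).drop (([] : List α).length + 1)) = mid ++ [c'] := rfl
    rw [hd] at hm h₁
    rw [List.take_left' hml] at hm
    rw [List.drop_left' hml] at h₁
    obtain ⟨-, h₁⟩ := h₁.of_singleton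
    refine ⟨L₀, k :: L ++ [k'], L₁, by simp, ht₀, h₁, ⟨k, by simp, L ++ [k'], rfl⟩,
      ⟨k', by simp, k :: L, rfl⟩, ?_⟩
    intro H' l r Ll Lr e hl hr hlh hrh
    have hmid : ∀ t ∈ mid, t.height = h := by
      obtain ⟨-, Ls, hLs, -⟩ := hm
      intro t ht
      obtain ⟨n, hn, rfl⟩ := List.getElem_of_mem ht
      exact (hLs.get hn (hLs.length_eq ▸ hn)).height_eq
    refine (wp_bwayJoin_dense (k := k) (k' := k') (by simpa [Nat.succ_le_iff] using hK) hl hr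
      (hm.mono e le_rfl) hlh hrh hmid).mono fun v cost H'' _ hq => ?_
    refine ⟨by simpa using hq.1, ?_, hq.2.2⟩
    have := hq.2.1; omega

/-- The one-sided bound `18 * h + 3 * v.height` is the potential that makes the induction close; the
last clause supplies the whole child that keeps a one-sided result high. The hypothesis `hk`
expresses that the lower end is below the upper one, although they live in different types. -/
theorem wp_threadSplit {B : ℕ} (hB : 2 ≤ B) {α : Type*} [LinearOrder α] {H : Heap B α} {h : ℕ}
    {r : Ref} {L : List α} {k₁ : WithBot α} {k₂ : WithTop α} (ht : IsSubtree H h 1 r L)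
    (hL : L.Pairwise (· < ·)) (hk : ∀ x : α, (x : WithBot α) ≤ k₁ → (x : WithTop α) < k₂) :
    (threadSplit bwayJoin h r.root k₁ k₂).wp H fun v c H' =>
      IsSubtree H' v.height 1 v (keysBetween k₁ k₂ L) ∧ v.height ≤ h ∧ c ≤ 50 * h ∧
      (k₁ = ⊥ ∨ k₂ = ⊤ → c ≤ 18 * h + 3 * v.height) ∧ (k₁ = ⊥ ∧ k₂ = ⊤ → v.height = h ∧ c = 0) := by
  induction h generalizing H r L k₁ k₂ with
  | zero =>
    obtain ⟨-, rfl⟩ := ht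
    exact ⟨⟨rfl, rfl⟩, by simp [Ref.empty], by simp, by simp, by simp [Ref.empty]⟩
  | succ h ih =>
    unfold threadSplit
    by_cases hfull : k₁ = ⊥ ∧ k₂ = ⊤
    · rw [if_pos hfull]
      obtain ⟨rfl, rfl⟩ := hfull
      have hr : (⟨h + 1, r.root⟩ : Ref) = r := by rw [← ht.height_eq]
      rw [hr, keysBetween_bot_top]
      have hh := ht.height_eq
      exact ⟨hh ▸ ht, hh.le, by simp, by simp, by simp [hh]⟩
    rw [if_neg hfull]
    obtain ⟨-, b, hb, hmb, hf⟩ := isSubtree_succ.1 ht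
    refine Prog.wp_read hb ?_
    by_cases h0 : h = 0
    · rw [if_pos h0]
      subst h0
      obtain rfl := hf.eq_keys
      have hle : (keysBetween k₁ k₂ b.keys).length ≤ B :=
        (List.length_filter_le ..).trans b.keys_le
      generalize hks : keysBetween k₁ k₂ b.keys = ks at hle ⊢
      unfold keysBetween at hks
      simp only [hks]
      split_ifs with hnil
      · obtain rfl := List.eq_nil_of_length_eq_zero hnil
        exact ⟨⟨rfl, rfl⟩, by simp [Ref.empty], by simp, by simp [Ref.empty],
          fun h => (hfull h).elim⟩
      · intro a H' e ha
        refine ⟨?_, by simp, by simp, by simp, fun h => (hfull h).elim⟩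
        exact isSubtree_of_ofLists (IsForest.replicate_empty H _ _) (by omega) hle e ha
    rw [if_neg h0]
    have hKs := List.Pairwise.sublist hf.keys_sublist hL
    obtain ⟨hi₁, hi₂⟩ := countP_split (p := fun x : α => (x : WithBot α) ≤ k₁)
      (fun x y hxy hy => by
        simp only [decide_eq_true_eq] at hy ⊢
        exact (WithBot.coe_le_coe.2 hxy).trans hy) hKs
    obtain ⟨hj₁, hj₂⟩ := countP_split (p := fun x : α => (x : WithTop α) < k₂)
      (fun x y hxy hy => by
        simp only [decide_eq_true_eq] at hy ⊢
        exact (WithTop.coe_le_coe.2 hxy).trans_lt hy) hKs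
    have hij : b.keys.countP (fun x : α => (x : WithBot α) ≤ k₁) ≤
        b.keys.countP fun x : α => (x : WithTop α) < k₂ :=
      List.countP_mono_left fun x _ hx => by simpa using hk x (by simpa using hx)
    have hjK : b.keys.countP (fun x : α => (x : WithTop α) < k₂) ≤ b.keys.length :=
      List.countP_le_length
    generalize b.keys.countP (fun x : α => (x : WithBot α) ≤ k₁) = i at *
    generalize b.keys.countP (fun x : α => (x : WithTop α) < k₂) = j at *
    simp only [decide_eq_true_eq, not_le, not_lt] at hi₁ hi₂ hj₁ hj₂
    obtain ⟨L', Y, rfl, hY, hf'⟩ := hf.cut_right hL hjK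
    have hL' := (List.pairwise_append.1 hL).1
    obtain ⟨X, M, rfl, hX, hfM⟩ := hf'.cut_left hL' (i := i) (by simp; omega)
    have hM := (List.pairwise_append.1 hL').2.1
    have hres : keysBetween k₁ k₂ (X ++ M ++ Y) = keysBetween k₁ k₂ M := by
      rw [keysBetween_append, keysBetween_append, keysBetween_eq_nil (L := X),
        keysBetween_eq_nil (L := Y)]
      · simp
      · intro y hy
        obtain ⟨z, hz, hzy⟩ := hY y hy
        exact .inr ((hj₂ z hz).trans (WithTop.coe_le_coe.2 hzy))
      · intro x hx
        obtain ⟨y, hy, hxy⟩ := hX x hx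
        rw [List.take_take, min_eq_left hij] at hy
        exact .inl ((WithBot.coe_le_coe.2 hxy).trans (hi₁ y hy))
    rw [hres]
    have hjR : j < b.refs.length := by have := hf.1; omega
    dsimp only
    split_ifs with hij'
    · subst hij'
      have hR : (b.refs.take (i + 1)).drop i = [b.refs.getD i Ref.empty] := by
        rw [List.drop_take, List.drop_eq_getElem_cons hjR, Nat.add_sub_cancel_left,
          List.take_succ_cons, List.take_zero, List.getD_eq_getElem _ _ hjR]
      rw [hR] at hfM
      obtain ⟨-, hc⟩ := hfM.of_singleton
      -- An inner node has at least `B / 2 ≥ 1` keys, so the child qualifies as a root.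
      refine (ih (hc.mono (.refl H) (by omega)) hM hk).mono fun v c H' _ hq => ?_
      obtain ⟨q₁, q₂, q₃, q₄, q₅⟩ := hq
      exact ⟨q₁, by omega, by omega, fun h => by have := q₄ h; omega, fun h => (hfull h).elim⟩
    · have hlt : i < j := by omega
      rw [take_drop_eq_cons_append _ Ref.empty hlt hjR, List.drop_take] at hfM
      obtain ⟨L₀, W, L₁, rfl, hc, hc', ⟨k, hkK, W₁, hW₁⟩, ⟨k', hkK', W₂, hW₂⟩, hjoin⟩ :=
        wp_bwayJoin_boundary hB hfM (by have := b.keys_le; simp; omega)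
      rw [keysBetween_middle hM hW₁ hW₂ (hi₂ k (List.mem_of_mem_take hkK))
        (hj₁ k' (by rw [← List.drop_take] at hkK'; exact List.mem_of_mem_drop hkK'))]
      have hs := List.pairwise_append.1 hM
      refine Prog.wp_bind ?_
      have h₁ := ih (k₁ := k₁) (k₂ := ⊤) (hc.mono (.refl H) (by omega))
        (List.pairwise_append.1 hs.1).1 fun x _ => WithTop.coe_lt_top x
      refine Prog.wp.mono (h₁.mono fun v c H' e hq => And.intro e hq) ?_
      rintro v c H' - ⟨e, q₁, q₂, -, q₄, q₅⟩
      refine Prog.wp_bind ?_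
      have h₂ := ih (k₁ := ⊥) (k₂ := k₂) (hc'.mono e (by omega))
        hs.2.1 fun x hx => absurd hx (WithBot.bot_lt_coe x).not_ge
      refine Prog.wp.mono (h₂.mono fun v c H' e hq => And.intro e hq) ?_
      rintro v' c' H'' - ⟨e', q₁', q₂', -, q₄', q₅'⟩
      have q₄ := q₄ (.inr rfl)
      have q₄' := q₄' (.inl rfl)
      refine (hjoin H'' v v' _ _ (e.trans e') (q₁.mono e' le_rfl) q₁' q₂ q₂').mono
        fun w cost H₃ _ hq => ?_
      obtain ⟨p₁, p₂, p₃, p₄⟩ := hq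
      -- The terms `3 * v.height` and `3 * v'.height` of the recursive costs cancel against the
      -- join: `1 + 2 * 18 * h + 6 * h + 9 ≤ 50 * (h + 1)`.
      refine ⟨p₁, p₃, by omega, fun hside => ?_, fun h => (hfull h).elim⟩
      have hmax : h ≤ max v.height v'.height := by
        obtain rfl | rfl := hside
        · rw [(q₅ ⟨rfl, rfl⟩).1]; exact le_max_left _ _
        · rw [(q₅' ⟨rfl, rfl⟩).1]; exact le_max_right _ _
      -- One recursive call is free and returns height `h`, so the total is at most `21 * h + 10`;
      -- the new height is at least `h`, and `18 * (h + 1) + 3 * h` covers it.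
      obtain rfl | rfl := hside
      · have := q₅ ⟨rfl, rfl⟩
        omega
      · have := q₅' ⟨rfl, rfl⟩
        omega

/-! ## A single thread of the multiway split -/

theorem wp_loadKey {B : ℕ} (hB : 0 < B) {α : Type*} {H : Heap B α} {base i : ℕ} {ks : List α}
    {k : Option α → Prog B α} {Q : Ref → ℕ → Heap B α → Prop} (hks : IsKeyArray H base ks)
    (hi : i < ks.length) (h : (k ks[i]?).wp H fun r c H' => Q r (c + 1) H') :
    (loadKey base i k).wp H Q := by
  have hdiv := Nat.div_add_mod' i B
  obtain ⟨b, hb, hbk⟩ := hks (i / B) (by omega)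
  refine Prog.wp_read hb ?_
  rwa [hbk, List.getElem?_take_of_lt (Nat.mod_lt _ hB), List.getElem?_drop, hdiv]

theorem lt_upperKey_of_le_lowerKey {α : Type*} [LinearOrder α] {ks : List α}
    (hks : ks.Pairwise (· < ·)) {i : ℕ} (hi : i ≤ ks.length) {x : α}
    (hx : (x : WithBot α) ≤ lowerKey ks i) : (x : WithTop α) < upperKey ks i := by
  unfold lowerKey at hx
  unfold upperKey
  obtain rfl | hi := hi.eq_or_lt
  · simp [WithTop.coe_lt_top]
  split_ifs at hx with h0
  · exact absurd hx (WithBot.bot_lt_coe x).not_ge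
  · rw [List.getElem?_eq_getElem (by omega)] at hx
    rw [List.getElem?_eq_getElem hi]
    have hx' : x ≤ ks[i - 1] := WithBot.coe_le_coe.1 hx
    have hlt : ks[i - 1] < ks[i] := List.pairwise_iff_getElem.1 hks _ _ _ _ (by omega)
    exact WithTop.coe_lt_coe.2 (hx'.trans_lt hlt)

theorem wp_splitThread {B : ℕ} (hB : 2 ≤ B) {α : Type*} [LinearOrder α] {H : Heap B α} {T : Ref}
    {L ks : List α} {base i : ℕ} (hT : IsBTree H T L) (hks : IsKeyArray H base ks)
    (hsort : ks.Pairwise (· < ·)) (hi : i ≤ ks.length) :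
    (splitThread bwayJoin T base ks.length i).wp H fun v c H' =>
      IsBTree H' v (keysBetween (lowerKey ks i) (upperKey ks i) L) ∧ c ≤ 50 * T.height + 2 := by
  have hw := (wp_threadSplit hB hT.1 hT.2 (k₁ := lowerKey ks i) (k₂ := upperKey ks i)
    fun x hx => lt_upperKey_of_le_lowerKey hsort hi hx).mono
    (Q' := fun v c H' => IsBTree H' v (keysBetween (lowerKey ks i) (upperKey ks i) L) ∧
      c ≤ 50 * T.height) fun v c H' _ hq => ⟨⟨hq.1, hT.2.sublist List.filter_sublist⟩, hq.2.2.1⟩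
  have hupper : (if i < ks.length then loadKey base i fun x =>
        threadSplit bwayJoin T.height T.root (lowerKey ks i) (x.elim ⊤ WithTop.some)
      else threadSplit bwayJoin T.height T.root (lowerKey ks i) ⊤ : Prog B α).wp H fun v c H' =>
      IsBTree H' v (keysBetween (lowerKey ks i) (upperKey ks i) L) ∧ c ≤ 50 * T.height + 1 := by
    split_ifs with h
    · exact wp_loadKey (by omega) hks h (hw.mono fun v c H' _ hq => ⟨hq.1, by omega⟩)
    · have hu : upperKey ks i = ⊤ := by simp [upperKey, List.getElem?_eq_none (not_lt.1 h)]
      rw [hu] at hw ⊢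
      exact hw.mono fun v c H' _ hq => ⟨hq.1, by omega⟩
  unfold splitThread
  dsimp only
  by_cases h0 : i = 0
  · rw [if_pos h0]
    have hl : lowerKey ks i = ⊥ := by simp [lowerKey, h0]
    rw [hl] at hupper ⊢
    exact hupper.mono fun v c H' _ hq => ⟨hq.1, by omega⟩
  · rw [if_neg h0]
    refine wp_loadKey (by omega) hks (by omega) ?_
    have hl : lowerKey ks i = (ks[i - 1]?).elim ⊥ WithBot.some := by simp [lowerKey, h0]
    rw [← hl]
    exact hupper.mono fun v c H' _ hq => ⟨hq.1, by omega⟩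

/-! ## Parallel loops -/

/-- An address that is free before the fork can be written only by the thread whose supply contains
it, so the first block found there is the right one. -/
theorem extends_merge {B : ℕ} {α : Type*} {m : ℕ} {H : Heap B α} {Hc : Fin m → Heap B α}
    {S : Fin m → Set ℕ} (hS : ∀ i j, i ≠ j → Disjoint (S i) (S j))
    (hext : ∀ i, Extends H (Hc i)) (hout : ∀ i a, a ∉ S i → Hc i a = H a) (i : Fin m) :
    Extends (Hc i) fun a => (H a).or ((List.finRange m).findSome? fun i => Hc i a) := by
  intro a b e
  rcases hH : H a with _ | b'
  · have hai : a ∈ S i := by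
      by_contra hai
      rw [hout i a hai, hH] at e
      simp at e
    simp only [hH, Option.none_or]
    rcases hf : (List.finRange m).findSome? fun i => Hc i a with _ | b''
    · rw [List.findSome?_eq_none_iff] at hf
      simpa [e] using hf i (List.mem_finRange i)
    · obtain ⟨j, -, hj⟩ := List.exists_of_findSome?_eq_some hf
      obtain rfl | hij := eq_or_ne i j
      · exact hj.symm.trans e
      · rw [hout j a (Set.disjoint_left.1 (hS i j hij) hai), hH] at hj
        simp at hj
  · simp only [hH, Option.some_or, ← hext i hH, e]

theorem IsDirectory.mono {B : ℕ} {α : Type*} {H H' : Heap B α} (hH : Extends H H') {t : ℕ}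
    {r : Ref} {Ts : List Ref} (h : IsDirectory H t r Ts) : IsDirectory H' t r Ts := by
  induction t generalizing r Ts with
  | zero => exact h
  | succ t ih =>
    obtain ⟨b, hb, Tss, hT, rfl⟩ := h
    exact ⟨b, hH hb, Tss, hT.imp fun _ _ h => ih h, rfl⟩

theorem freshSupply_pair {B : ℕ} {α : Type*} {s : ℕ → ℕ} {H : Heap B α} (hs : FreshSupply s H)
    (i : ℕ) : FreshSupply (fun j => s (Nat.pair i j)) H :=
  ⟨fun _ _ hxy => (Nat.pair_eq_pair.1 (hs.1 hxy)).2, fun _ => hs.2 _⟩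

theorem disjoint_range_pair {s : ℕ → ℕ} (hs : Function.Injective s) {i j : ℕ} (hij : i ≠ j) :
    Disjoint (Set.range fun n => s (Nat.pair i n)) (Set.range fun n => s (Nat.pair j n)) := by
  rw [Set.disjoint_left]
  rintro _ ⟨x, rfl⟩ ⟨y, hy⟩
  exact hij (Nat.pair_eq_pair.1 (hs hy)).1.symm

theorem sum_min_sub (M m q : ℕ) : ∑ c : Fin q, min M (m - c * M) = min m (q * M) := by
  induction q with
  | zero => simp
  | succ q ih =>
    rw [Fin.sum_univ_castSucc]
    simp only [Fin.val_castSucc, Fin.val_last, ih, Nat.succ_mul]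
    omega

theorem range'_eq_flatten (M m lo q : ℕ) :
    List.range' lo (min m (q * M)) =
      (List.ofFn fun c : Fin q => List.range' (lo + c * M) (min M (m - c * M))).flatten := by
  induction q with
  | zero => simp
  | succ q ih =>
    rw [List.ofFn_succ_last, List.flatten_concat]
    simp only [Fin.val_castSucc, Fin.val_last, ← ih]
    obtain h | h := le_total m (q * M)
    · have h1 : m - q * M = 0 := by omega
      have h2 : min m ((q + 1) * M) = m := by rw [Nat.succ_mul]; omega
      simp [h1, h2, min_eq_left h]
    · have h2 : min m ((q + 1) * M) = q * M + min M (m - q * M) := by rw [Nat.succ_mul]; omega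
      rw [min_eq_right h, h2, List.range'_append_1]

/-- A level adds a fork and a write to the span. For the work, complete fork trees are treated
separately: they leave a surplus of `4`, which pays for the overhead above them. Only the last child
can be incomplete; it may be a chain of unary forks, each costing `3`, whence the term `3 * t`. -/
theorem run_parFor {B : ℕ} (hB : 2 ≤ B) {α : Type*} {H : Heap B α} {body : ℕ → Prog B α}
    {N w : ℕ} {P : ℕ → Ref → Heap B α → Prop}
    (hP : ∀ i r H' H'', Extends H' H'' → P i r H' → P i r H'')
    (hbody : ∀ i < N, (body i).wp H fun r c H' => P i r H' ∧ c ≤ w)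
    (t lo m : ℕ) (s : ℕ → ℕ) (hm : 1 ≤ m) (hmt : m ≤ B ^ t) (hN : lo + m ≤ N)
    (hs : FreshSupply s H) :
    let o := (parFor body t lo m).run s H
    Extends H o.heap ∧ (∀ a, a ∉ Set.range s → o.heap a = H a) ∧
      (∃ Ts, IsDirectory o.heap t o.val Ts ∧
        List.Forall₂ (fun i r => P i r o.heap) (List.range' lo m) Ts) ∧
      o.span ≤ 2 * t + w ∧ o.space ≤ max w 2 ∧ o.work ≤ m * (w + 4) + 3 * t ∧
      (m = B ^ t → o.work + 4 ≤ m * (w + 4)) := by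
  induction t generalizing lo m s with
  | zero =>
    obtain rfl : m = 1 := by simp at hmt; omega
    obtain ⟨h₁, h₂, h₃, h₄, h₅⟩ := (hbody lo (by omega)).run hs
    refine ⟨h₁, h₂, ⟨[_], rfl, ?_⟩, ?_, ?_, ?_, ?_⟩
    · exact .cons h₃.1 .nil
    all_goals simp only [parFor]; omega
  | succ t ih =>
    set M := B ^ t with hM
    have hM0 : 0 < M := Nat.pow_pos (by omega)
    have hpow : B ^ (t + 1) = B * M := pow_succ' B t
    have hceil : (m + M - 1) / M ≤ B := by
      rw [Nat.div_le_iff_le_mul_add_pred hM0]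
      rw [hpow] at hmt
      have : m ≤ M * B := by rw [mul_comm]; exact hmt
      omega
    set q := min B ((m + M - 1) / M) with hq
    have hqe : q = (m + M - 1) / M := min_eq_right hceil
    have hq1 : 1 ≤ q := by
      rw [hqe, Nat.le_div_iff_mul_le hM0]; omega
    have hmq : m ≤ q * M := by
      have := Nat.lt_div_mul_add hM0 (a := m + M - 1)
      rw [← hqe] at this
      omega
    have hqm : (q - 1) * M < m := by
      have := Nat.div_mul_le_self (m + M - 1) M
      rw [← hqe] at this
      have h2 : (q - 1) * M + M = q * M := by
        rw [← Nat.succ_mul]; congr 1; omega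
      omega
    have hcm : ∀ c : Fin q, c * M < m := fun c =>
      (Nat.mul_le_mul_right M (by have := c.2; omega)).trans_lt hqm
    let o : Fin q → Outcome B α := fun c =>
      (parFor body t (lo + c * M) (min M (m - c * M))).run
        (fun j => s (Nat.pair (c + 1) j)) H
    have ho : ∀ c : Fin q, _ := fun c =>
      ih (lo + c * M) (min M (m - c * M)) (fun j => s (Nat.pair (c + 1) j))
        (by have := hcm c; omega) (min_le_left _ _) (by have := hcm c; omega)
        (freshSupply_pair hs _)
    change ∀ c : Fin q, Extends H (o c).heap ∧
      (∀ a, a ∉ Set.range (fun j => s (Nat.pair (c + 1) j)) → (o c).heap a = H a) ∧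
      (∃ Ts, IsDirectory (o c).heap t (o c).val Ts ∧
        List.Forall₂ (fun i r => P i r (o c).heap)
          (List.range' (lo + c * M) (min M (m - c * M))) Ts) ∧
      (o c).span ≤ 2 * t + w ∧ (o c).space ≤ max w 2 ∧
      (o c).work ≤ min M (m - c * M) * (w + 4) + 3 * t ∧
      (min M (m - c * M) = M → (o c).work + 4 ≤ min M (m - c * M) * (w + 4)) at ho
    let G : Heap B α := fun a => (H a).or ((List.finRange q).findSome? fun i => (o i).heap a)
    let a₀ := s (Nat.pair 0 0)
    let b : Block B α := Block.ofLists B [] (List.ofFn fun c => (o c).val)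
    let G' := Function.update G a₀ (some b)
    have hrun : (parFor body (t + 1) lo m).run s H = ⟨⟨t + 1, a₀⟩, G',
        1 + q + (∑ c, (o c).work) + 1, 1 + (Finset.univ.sup fun c => (o c).span) + 1,
        max (Finset.univ.sup fun c => (o c).space) 2⟩ := rfl
    have hHG : ∀ a, a ∉ Set.range s → G a = H a := by
      intro a ha
      have hc : ∀ c, (o c).heap a = H a := fun c => (ho c).2.1 a fun ⟨j, hj⟩ => ha ⟨_, hj⟩
      change (H a).or _ = _
      simp only [hc]
      rcases H a with _ | b
      · simp
      · rfl
    have hext : ∀ c, Extends (o c).heap G := extends_merge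
      (S := fun c : Fin q => Set.range fun j => s (Nat.pair (c + 1) j))
      (fun i j hij => disjoint_range_pair hs.1 fun h => hij (Fin.ext (by omega)))
      (fun c => (ho c).1) fun c a ha => (ho c).2.1 a ha
    -- Index `0` of the pairing is reserved for the parent and children use `c + 1`, so no child has
    -- written here.
    have ha₀ : G a₀ = none := by
      have hc : ∀ c, (o c).heap a₀ = none := fun c => by
        rw [(ho c).2.1, hs.2]
        rintro ⟨j, hj⟩
        simpa using (Nat.pair_eq_pair.1 (hs.1 hj)).1
      change (H a₀).or _ = _
      simp only [hc, hs.2 _, a₀]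
      simp
    have hGG : Extends G G' := extends_update ha₀ b
    have hext' : ∀ c, Extends (o c).heap G' := fun c => (hext c).trans hGG
    have hHG' : Extends H G' := (ho ⟨0, hq1⟩).1.trans (hext' _)
    choose Ts hTs using fun c => (ho c).2.2.1
    have hsum : ∑ c : Fin q, min M (m - c * M) = m := by
      rw [sum_min_sub, min_eq_left hmq]
    rw [hrun]
    refine ⟨hHG', fun a ha => ?_, ⟨(List.ofFn Ts).flatten, ?_, ?_⟩, ?_, ?_, ?_, ?_⟩
    · change Function.update G a₀ (some b) a = H a
      rw [Function.update_of_ne, hHG a ha]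
      rintro rfl
      exact ha ⟨_, rfl⟩
    · have hb : G' a₀ = some b := Function.update_self ..
      refine ⟨b, hb, List.ofFn Ts, ?_, rfl⟩
      change List.Forall₂ _ (Block.ofLists B [] (List.ofFn fun c => (o c).val)).refs _
      rw [Block.ofLists_refs _ (by simp; omega), List.forall₂_iff_get]
      refine ⟨by simp, fun i h₁ h₂ => ?_⟩
      simpa using (hTs ⟨i, by simpa using h₁⟩).1.mono (hext' _)
    · have := range'_eq_flatten M m lo q
      rw [min_eq_left hmq] at this
      rw [this]
      refine List.rel_flatten ?_
      rw [List.forall₂_iff_get]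
      refine ⟨by simp, fun i h₁ h₂ => ?_⟩
      simpa using (hTs ⟨i, by simpa using h₁⟩).2.imp fun _ _ h => hP _ _ _ _ (hext' _) h
    · have : (Finset.univ.sup fun c => (o c).span) ≤ 2 * t + w :=
        Finset.sup_le fun c _ => (ho c).2.2.2.1
      dsimp only
      omega
    · have : (Finset.univ.sup fun c => (o c).space) ≤ max w 2 :=
        Finset.sup_le fun c _ => (ho c).2.2.2.2.1
      dsimp only
      omega
    -- The surpluses `4 * q` pay for the overhead `q + 2`; only the last child may exceed its share,
    -- by `3 * t + 4`. What remains is `6 - 3 * q ≤ 3`.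
    · have hle : ∑ c : Fin q, ((o c).work + 4) ≤
          ∑ c : Fin q, (min M (m - c * M) * (w + 4) +
            if c = ⟨q - 1, by omega⟩ then 3 * t + 4 else 0) := by
        refine Finset.sum_le_sum fun c _ => ?_
        split_ifs with hc
        · have := (ho c).2.2.2.2.2.1; omega
        · refine (ho c).2.2.2.2.2.2 (min_eq_left ?_)
          have hc' : c + 1 ≤ q - 1 := by
            have := c.2
            have : (c : ℕ) ≠ q - 1 := fun h => hc (Fin.ext h)
            omega
          have := Nat.mul_le_mul_right M hc'
          rw [Nat.succ_mul] at this
          omega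
      rw [Finset.sum_add_distrib, Finset.sum_add_distrib, ← Finset.sum_mul, hsum,
        Finset.sum_ite_eq' Finset.univ, if_pos (Finset.mem_univ _), Finset.sum_const,
        Finset.card_univ, Fintype.card_fin, smul_eq_mul] at hle
      dsimp only
      omega
    · intro hfull
      -- A complete tree has `B ≥ 2` complete children, so `6 - 3 * q ≤ 0` and the surplus `4` is
      -- restored.
      have hqB : B ≤ q := by
        by_contra hlt
        have : q * M < B * M := Nat.mul_lt_mul_of_pos_right (by omega) hM0
        rw [hpow] at hfull
        omega
      have hle : ∑ c : Fin q, ((o c).work + 4) ≤ ∑ c : Fin q, min M (m - c * M) * (w + 4) := by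
        refine Finset.sum_le_sum fun c _ => (ho c).2.2.2.2.2.2 (min_eq_left ?_)
        have hc' : c + 1 ≤ B := by have := c.2; omega
        have := Nat.mul_le_mul_right M hc'
        rw [Nat.succ_mul] at this
        rw [hpow] at hfull
        omega
      rw [Finset.sum_add_distrib, ← Finset.sum_mul, hsum, Finset.sum_const,
        Finset.card_univ, Fintype.card_fin, smul_eq_mul] at hle
      dsimp only
      omega

/-! ## Logarithmic bounds -/

theorem IsForest.mul_le_length {B : ℕ} {α : Type*} {H : Heap B α} {h m p : ℕ} {R : List Ref}
    {K L : List α} (hp : ∀ r L, IsSubtree H h m r L → p ≤ L.length + 1)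
    (hf : IsForest H h m R K L) : (K.length + 1) * p ≤ L.length + 1 := by
  induction K generalizing R L with
  | nil =>
    obtain ⟨c, -, ht⟩ := hf.exists_singleton
    simpa using hp c L ht
  | cons k K ih =>
    obtain ⟨L₁, L₂, h₁, h₂, rfl⟩ := IsForest.split (K₁ := []) hf
    obtain ⟨c, -, ht⟩ := h₁.exists_singleton
    have h₃ := hp c L₁ ht
    have h₄ := ih h₂
    rw [List.length_append, List.length_cons, List.length_cons, Nat.succ_mul]
    omega

theorem IsSubtree.pow_le_length {B : ℕ} {α : Type*} {H : Heap B α} {h : ℕ} {r : Ref}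
    {L : List α} (ht : IsSubtree H h (B / 2) r L) : (B / 2 + 1) ^ h ≤ L.length + 1 := by
  induction h generalizing r L with
  | zero => simp
  | succ h ih =>
    obtain ⟨-, b, -, hm, hf⟩ := isSubtree_succ.1 ht
    rw [pow_succ']
    exact (Nat.mul_le_mul_right _ (by omega)).trans (hf.mul_le_length fun r L => ih)

/-- Below a root with at least two children the degree is at least `B / 2 + 1`, which is at least
`√B`; the square root accounts for the factor `2`. For the empty tree, `Real.logb` is `0` at `0`. -/
theorem IsSubtree.height_le_logb {B : ℕ} (hB : 2 ≤ B) {α : Type*} {H : Heap B α} {h : ℕ}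
    {r : Ref} {L : List α} (ht : IsSubtree H h 1 r L) :
    (h : ℝ) ≤ 2 * Real.logb B L.length + 1 := by
  obtain _ | h := h
  · obtain ⟨-, rfl⟩ := ht
    simp
  · obtain ⟨-, b, -, hm, hf⟩ := isSubtree_succ.1 ht
    have h₁ := hf.mul_le_length fun r L h => h.pow_le_length
    have h₂ : 2 * (B / 2 + 1) ^ h ≤ L.length + 1 :=
      (Nat.mul_le_mul_right _ (by omega)).trans h₁
    have h₃ : 1 ≤ (B / 2 + 1) ^ h := Nat.one_le_pow _ _ (by omega)
    -- The two children of the root give `2 * x ≤ n + 1`, and `x ≥ 1` turns this into `x ≤ n`,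
    -- removing the `+ 1`.
    have h₄ : (B / 2 + 1) ^ h ≤ L.length := by omega
    have h₅ : B ≤ (B / 2 + 1) ^ 2 := by
      have : B ≤ 2 * (B / 2) + 1 := by omega
      nlinarith
    have h₆ : B ^ h ≤ L.length ^ 2 := by
      calc B ^ h ≤ ((B / 2 + 1) ^ 2) ^ h := Nat.pow_le_pow_left h₅ h
        _ = ((B / 2 + 1) ^ h) ^ 2 := pow_right_comm _ _ _
        _ ≤ L.length ^ 2 := Nat.pow_le_pow_left h₄ 2
    have hB' : (1 : ℝ) < B := by exact_mod_cast hB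
    have h₇ : Real.logb B ((B : ℝ) ^ h) ≤ Real.logb B ((L.length : ℝ) ^ 2) :=
      Real.logb_le_logb_of_le hB' (by positivity) (by exact_mod_cast h₆)
    rw [Real.logb_pow, Real.logb_pow, Real.logb_self_eq_one hB'] at h₇
    push_cast at h₇ ⊢
    linarith

theorem pow_clog_pred_le {B d : ℕ} (hB : 2 ≤ B) (hd : 1 ≤ d) :
    B ^ (Nat.clog B (d + 1) - 1) ≤ d :=
  Nat.lt_succ_iff.1 (Nat.pow_pred_clog_lt_self (by omega) (by omega))

theorem clog_le_logb {B d : ℕ} (hB : 2 ≤ B) (hd : 1 ≤ d) :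
    (Nat.clog B (d + 1) : ℝ) ≤ Real.logb B d + 1 := by
  have hB' : (1 : ℝ) < B := by exact_mod_cast hB
  have h := Real.logb_le_logb_of_le hB' (by positivity)
    (by exact_mod_cast pow_clog_pred_le hB hd : (B : ℝ) ^ (Nat.clog B (d + 1) - 1) ≤ d)
  rw [Real.logb_pow, Real.logb_self_eq_one hB', mul_one] at h
  have h' : (Nat.clog B (d + 1) : ℝ) ≤ (Nat.clog B (d + 1) - 1 : ℕ) + 1 := by
    exact_mod_cast (by omega : Nat.clog B (d + 1) ≤ Nat.clog B (d + 1) - 1 + 1)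
  linarith

theorem clog_le {B d : ℕ} (hB : 2 ≤ B) (hd : 1 ≤ d) : Nat.clog B (d + 1) ≤ d := by
  have h := (Nat.lt_pow_self (n := Nat.clog B (d + 1) - 1) hB).trans_le (pow_clog_pred_le hB hd)
  omega

theorem logb_natCast_nonneg {B : ℕ} (hB : 2 ≤ B) (n : ℕ) : 0 ≤ Real.logb B n := by
  obtain rfl | hn := n.eq_zero_or_pos
  · simp
  · exact Real.logb_nonneg (by exact_mod_cast hB) (by exact_mod_cast hn)

/-! ### Assembly of the bounds. -/

theorem mainTheorem4 :
    ∃ C : ℝ, 0 < C ∧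
      ∀ (B : ℕ) (_ : 2 ≤ B) (α : Type*) [LinearOrder α],
        ∃ J : JoinProg B α, IsBWayJoin J ∧
          ∀ (H : Heap B α) (s : ℕ → ℕ) (T : Ref) (L : List α) (base : ℕ) (ks : List α),
            FreshSupply s H →
            IsBTree H T L →
            IsKeyArray H base ks →
            ks.Pairwise (· < ·) →
            1 ≤ ks.length →
            let o := (multiSplit J T base ks.length).run s H
            (∃ Ts : Fin (ks.length + 1) → Ref,
              IsDirectory o.heap (Nat.clog B (ks.length + 1)) o.val (List.ofFn Ts) ∧
              ∀ i, IsBTree o.heap (Ts i)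
                (L.filter fun x => lowerKey ks i < (x : WithBot α) ∧
                  (x : WithTop α) < upperKey ks i)) ∧
            (o.span : ℝ) ≤ C * (Real.logb B ks.length + Real.logb B L.length + 1) ∧
            (o.work : ℝ) ≤ C * (ks.length * (Real.logb B L.length + 1)) ∧
            (o.space : ℝ) ≤ C * (Real.logb B L.length + 1) := by
  -- The work dictates the constant: `50` per level, a factor `2` from the height bound, and a
  -- factor `2` from `d + 1 ≤ 2 * d`.
  refine ⟨200, by norm_num, fun B hB α _ => ⟨bwayJoin, isBWayJoin_bwayJoin hB, ?_⟩⟩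
  intro H s T L base ks hs hT hks hsort hd
  obtain ⟨-, -, ⟨Ts, hdir, hTs⟩, hspan, hspace, hwork, -⟩ := run_parFor hB
    (P := fun i r H' => IsBTree H' r (keysBetween (lowerKey ks i) (upperKey ks i) L))
    (fun i r H' H'' e h => ⟨h.1.mono e le_rfl, h.2⟩)
    (fun i hi => wp_splitThread hB hT hks hsort (Nat.lt_succ_iff.1 hi))
    (Nat.clog B (ks.length + 1)) 0 (ks.length + 1) s (by omega)
    (Nat.le_pow_clog (by omega) _) (by omega) hs
  have hheight := hT.1.height_le_logb hB
  have hclog := clog_le_logb hB hd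
  have hclog' := clog_le hB hd
  have hn := logb_natCast_nonneg hB L.length
  have hdn := logb_natCast_nonneg hB ks.length
  have hd' : (1 : ℝ) ≤ ks.length := by exact_mod_cast hd
  rw [max_eq_left (by omega)] at hspace
  refine ⟨?_, ?_, ?_, ?_⟩
  · have hlen : Ts.length = ks.length + 1 := by simpa using hTs.length_eq.symm
    obtain ⟨f, rfl⟩ : ∃ f : Fin (ks.length + 1) → Ref, Ts = List.ofFn f :=
      ⟨fun i => Ts[i], List.ext_getElem (by simpa using hlen) fun i _ _ => by
        rw [List.getElem_ofFn]; rfl⟩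
    refine ⟨f, hdir, fun i => ?_⟩
    have h := hTs.get (i := i) (by simpa using i.is_le) (by simpa using i.is_le)
    simp only [List.get_eq_getElem, List.getElem_range', List.getElem_ofFn, zero_add,
      one_mul] at h
    exact h
  · have h : _ ≤ (_ : ℝ) := Nat.cast_le.2 hspan
    push_cast at h
    exact h.trans (by linarith)
  · have h : _ ≤ (_ : ℝ) := Nat.cast_le.2 hwork
    push_cast at h
    -- For the work, the crude bound `t ≤ d` suffices to absorb the term `3 * t`.
    have hclog'' : (Nat.clog B (ks.length + 1) : ℝ) ≤ ks.length := by exact_mod_cast hclog'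
    refine h.trans ?_
    calc ((ks.length : ℝ) + 1) * (50 * T.height + 2 + 4) + 3 * Nat.clog B (ks.length + 1)
        ≤ (2 * ks.length) * (100 * Real.logb B L.length + 56) + 3 * ks.length :=
          add_le_add (mul_le_mul (by linarith) (by linarith) (by positivity) (by positivity))
            (by linarith)
      _ ≤ 200 * (ks.length * (Real.logb B L.length + 1)) := by nlinarith
  · have h : _ ≤ (_ : ℝ) := Nat.cast_le.2 hspace
    push_cast at h
    exact h.trans (by linarith)
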